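/- **Game (Model B3 of baccara chemin de fer).** Let $d$ be a positive integer. Cards are dealt without replacement from a $d$-deck shoe, which has $16d$ cards of value $0$ and $4d$ cards of each value $1,\dots,9$. The total of a hand is the sum of its values modulo $10$. Player and Banker are dealt two cards each. If either two-card total is $8$ or $9$, the game ends at once. Otherwise Player, who sees his own two cards, must draw a third card on totals $0$–$4$, must stand on totals $6,7$, and chooses freely on total $5$; his third card, if any, is dealt face up. Then Banker, who sees his own two cards and Player's third card ($\varnothing$ if Player stands), draws a third card or stands, as he chooses. The higher total wins one unit; equal totals give $0$. A pure strategy of Player is the set of two-card hands $(i,j)$, $i\le j$, on which he draws ($2^5$ strategies); one of Banker is the set of triples (own two-card hand with total $\le7$, Player's third card or $\varnothing$) on which he draws ($2^{484}$ strategies). The payoff to Player is his expected profit, so this is a zero-sum matrix game. Model A3 is the same game with the cards dealt with replacement from a single deck. **Theorem.** For every positive integer $d$ the following mixed strategies are optimal for Player and Banker in Model B3, and the value of the game (to Player) is the number $v_d$ below. *Player* draws on $(0,5),(6,9),(7,8)$, stands on $(2,3)$, and draws on $(1,4)$ with probability $$p_1=\frac1{19},\qquad p_d=\frac{(12d-1)(16d^2-14d+1)}{32d^2(11d-1)}\quad(d\ge2).$$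 *Banker, when Player's third card is $k\in\{0,\dots,9\}$:* - total $0,1,2$: draw; - total $3$: draw, except that for $k=8$ he stands, unless $d=1$ and his hand is $(4,9)$ or $(6,7)$; - total $4$: draw if $2\le k\le7$; also draw if $k=1$, $d\le2$ and the hand is $(6,8)$ or $(7,7)$; otherwise stand; - total $5$: draw if $5\le k\le7$; for $k=4$ draw on $(0,5),(6,9),(7,8)$ if $d\ge2$, on $(1,4)$ if $d\ge8$, on $(2,3)$ if $d\ge9$; otherwise stand; - total $6$: draw if $k=7$; draw if $k=6$, except on $(3,3)$ if $d\le3$; otherwise stand; - total $7$: stand. *Banker, when Player stands:* draw on totals $0$–$5$ and stand on total $7$. On total $6$, stand on $(1,5),(2,4),(3,3),(7,9)$. If $d\ge2$, draw on $(8,8)$ and draw on $(0,6)$ with probability $q_d$; if $d=1$, stand on $(0,6)$ and draw on $(8,8)$ with probability $q_1$. Here $$q_1=\frac{4519}{10716},\quad q_2=\frac{17431}{64512},\quad q_3=\frac{4425647}{11132928},\quad q_8=\frac{316815305}{585842688},$$ $$q_d=\frac{92160d^4-120128d^3+26336d^2-2000d+47}{256d^2(11d-1)(52d-5)}\quad(4\le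 d\le7),$$ $$q_d=\frac{91648d^4-119488d^3+26032d^2-1932d+41}{256d^2(11d-1)(52d-5)}\quad(d\ge9).$$ *Value*, with $(52d)_6=\prod_{i=0}^{5}(52d-i)$: $$v_1=-\frac{37833961}{2901089100},\quad v_2=-\frac{49424010137}{3823801581600},\quad v_3=-\frac{31717439249}{2461444457472},\quad v_8=-\frac{2789416947665657}{217430324984396160},$$ $$v_d=-\frac{2(1390665728d^7-491115520d^6+50698240d^5+2428032d^4-990512d^3+89192d^2-3462d+47)}{(11d-1)(52d)_6}\quad(4\le d\le7),$$ $$v_d=-\frac{2(1391755264d^7-500535296d^6+54174464d^5+1931136d^4-948816d^3+85792d^2-3238d+41)}{(11d-1)(52d)_6}\quad(d\ge9).$$ As $d\to\infty$, $p_d\to6/11$, $q_d\to179/286$ and $v_d\to-679568/53094899$. The last number is the value of Model A3, and in Model A3 the strategies above with $p=6/11$, $q=179/286$ and Banker's table for $d\ge9$ are optimal. -/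

import Mathlib

/-! Two-person zero-sum matrix games. -/

namespace MatrixGame

/-- Expected payoff to the row player when the players use the mixed strategies `p` and `q`. -/
noncomputable def expected {m n : Type} [Fintype m] [Fintype n]
    (A : m → n → ℝ) (p : m → ℝ) (q : n → ℝ) : ℝ :=
  ∑ i, ∑ j, p i * q j * A i j

/-- `p` is a mixed strategy of the row player that guarantees him an expected payoff of at
least `v`. -/
def RowGuarantees {m n : Type} [Fintype m] [Fintype n]
    (A : m → n → ℝ) (p : m → ℝ) (v : ℝ) : Prop :=
  p ∈ stdSimplex ℝ m ∧ ∀ q ∈ stdSimplex ℝ n, v ≤ expected A p q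

/-- `q` is a mixed strategy of the column player that holds the row player to an expected payoff
of at most `v`. -/
def ColGuarantees {m n : Type} [Fintype m] [Fintype n]
    (A : m → n → ℝ) (q : n → ℝ) (v : ℝ) : Prop :=
  q ∈ stdSimplex ℝ n ∧ ∀ p ∈ stdSimplex ℝ m, expected A p q ≤ v

/-- `v` is the value of the game: the largest amount that the row player can guarantee and the
smallest amount to which the column player can hold him. -/
def HasValue {m n : Type} [Fintype m] [Fintype n] (A : m → n → ℝ) (v : ℝ) : Prop :=
  IsGreatest {w | ∃ p, RowGuarantees A p w} v ∧ IsLeast {w | ∃ q, ColGuarantees A q w} v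

/-- The game has value `v`, and `p` and `q` are optimal mixed strategies of the row player and
the column player. -/
def IsSolution {m n : Type} [Fintype m] [Fintype n]
    (A : m → n → ℝ) (p : m → ℝ) (q : n → ℝ) (v : ℝ) : Prop :=
  HasValue A v ∧ RowGuarantees A p v ∧ ColGuarantees A q v

end MatrixGame

/-! The game of baccara. -/

namespace Baccara

/-- The value of a card: aces count 1, tens and court cards count 0, and each of the denominations
2 to 9 counts its number. -/
abbrev CardValue : Type := Fin 10

/-- A two-card hand, written `(i, j)` with `i ≤ j`. -/
abbrev Hand : Type := CardValue × CardValue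

/-- The hand formed by two cards, in whichever order they were dealt. -/
def mkHand (a b : CardValue) : Hand := (min a b, max a b)

/-- The total of a list of cards: the last digit of the sum of the values. -/
def total (l : List CardValue) : ℕ := (l.map Fin.val).sum % 10

/-- The total of a two-card hand. -/
def handTotal (h : Hand) : ℕ := total [h.1, h.2]

/-- All two-card hands. -/
def hands : Finset Hand := Finset.univ.filter fun h => h.1 ≤ h.2

/-- The hands on which Player must draw. -/
def mustDraw : Finset Hand := hands.filter fun h => handTotal h ≤ 4

/-- The hands on which Player may draw. -/
def mayDraw : Finset Hand := hands.filter fun h => handTotal h ≤ 5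

/-- The situations in which Banker may have to move: his own two-card hand, which is not a
natural, and Player's third card (`none` if Player stands). -/
def bankerSituations : Finset (Hand × Option CardValue) :=
  (hands.filter fun h => handTotal h ≤ 7) ×ˢ Finset.univ

/-- Player's pure strategies: the set of hands on which he draws. -/
abbrev PlayerPure : Type := {S : Finset Hand // mustDraw ⊆ S ∧ S ⊆ mayDraw}

/-- Banker's pure strategies: the set of situations in which he draws. -/
abbrev BankerPure : Type := {T : Finset (Hand × Option CardValue) // T ⊆ bankerSituations}

/-- Player's profit from a one-unit bet when the final totals of Player and Banker are
`x` and `y`. -/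
def score (x y : ℕ) : ℝ := if y < x then 1 else if x < y then -1 else 0

/-- The law of the next card: `deal l v` is the conditional probability that the next card has
value `v`, given that the cards in the list `l` have already been dealt. -/
abbrev Dealing : Type := List CardValue → CardValue → ℝ

/-- The number of cards of value `v` in a single deck. -/
def deckCount (v : CardValue) : ℕ := if v = 0 then 16 else 4

/-- Dealing without replacement from a `d`-deck shoe.  (If `l` holds more cards of some value than
the shoe does, then `l` has probability zero and the conditional probability is immaterial.) -/
noncomputable def shoe (d : ℕ) : Dealing := fun l v =>
  ((d * deckCount v : ℝ) - (l.count v : ℝ)) / (52 * (d : ℝ) - (l.length : ℝ))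

/-- Dealing with replacement from a single deck. -/
noncomputable def withReplacement : Dealing := fun _ v => (deckCount v : ℝ) / 52

/-- Player's conditional expected profit when the pure strategies `S` and `T` are used, given
that Player holds `x₁`, `x₂` and Banker holds `y₁`, `y₂`. -/
noncomputable def profit (deal : Dealing) (S : PlayerPure) (T : BankerPure)
    (x₁ x₂ y₁ y₂ : CardValue) : ℝ :=
  if 8 ≤ total [x₁, x₂] ∨ 8 ≤ total [y₁, y₂] then
    score (total [x₁, x₂]) (total [y₁, y₂])
  else if mkHand x₁ x₂ ∈ S.1 then
    ∑ k, deal [x₁, x₂, y₁, y₂] k *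
      (if (mkHand y₁ y₂, some k) ∈ T.1 then
        ∑ l, deal [x₁, x₂, y₁, y₂, k] l * score (total [x₁, x₂, k]) (total [y₁, y₂, l])
      else
        score (total [x₁, x₂, k]) (total [y₁, y₂]))
  else if (mkHand y₁ y₂, none) ∈ T.1 then
    ∑ l, deal [x₁, x₂, y₁, y₂] l * score (total [x₁, x₂]) (total [y₁, y₂, l])
  else
    score (total [x₁, x₂]) (total [y₁, y₂])

/-- The payoff matrix: Player's expected profit when the pure strategies `S` and `T` are used. -/
noncomputable def payoff (deal : Dealing) (S : PlayerPure) (T : BankerPure) : ℝ :=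
  ∑ x₁, deal [] x₁ * ∑ x₂, deal [x₁] x₂ * ∑ y₁, deal [x₁, x₂] y₁ * ∑ y₂, deal [x₁, x₂, y₁] y₂ *
    profit deal S T x₁ x₂ y₁ y₂

/-! Player's strategy. -/

/-- Of the hands with total 5, Player draws on `(0,5)`, `(6,9)`, `(7,8)` only. -/
def playerStands14 : PlayerPure := ⟨mustDraw ∪ {(0, 5), (6, 9), (7, 8)}, by decide⟩

/-- Of the hands with total 5, Player draws on `(0,5)`, `(6,9)`, `(7,8)`, `(1,4)` only. -/
def playerDraws14 : PlayerPure := ⟨mustDraw ∪ {(0, 5), (6, 9), (7, 8), (1, 4)}, by decide⟩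

/-- The mixed strategy of drawing on `(0,5)`, `(6,9)`, `(7,8)`, standing on `(2,3)`, and drawing on
`(1,4)` with probability `p`. -/
noncomputable def playerMixed (p : ℝ) : PlayerPure → ℝ :=
  (1 - p) • Pi.single playerStands14 1 + p • Pi.single playerDraws14 1

/-! Banker's strategy. -/

/-- The hand on which Banker randomizes when Player stands. -/
def mixedHand (d : ℕ) : Hand := if d = 1 then (8, 8) else (0, 6)

/-- Banker's move (`true` for draw) in every situation, except that on `mixedHand d` when Player
stands the entry is not final (it says `false`). -/
def bankerTable (d : ℕ) (h : Hand) : Option CardValue → Bool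
  | some k =>
    match handTotal h with
    | 0 | 1 | 2 => true
    | 3 => k ≠ 8 ∨ (d = 1 ∧ (h = (4, 9) ∨ h = (6, 7)))
    | 4 => (2 ≤ k ∧ k ≤ 7) ∨ (k = 1 ∧ d ≤ 2 ∧ (h = (6, 8) ∨ h = (7, 7)))
    | 5 => (5 ≤ k ∧ k ≤ 7) ∨
        (k = 4 ∧
          ((2 ≤ d ∧ (h = (0, 5) ∨ h = (7, 8) ∨ h = (6, 9))) ∨
            (8 ≤ d ∧ h = (1, 4)) ∨ (9 ≤ d ∧ h = (2, 3))))
    | 6 => k = 7 ∨ (k = 6 ∧ (h ≠ (3, 3) ∨ 4 ≤ d))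
    | _ => false
  | none =>
    match handTotal h with
    | 0 | 1 | 2 | 3 | 4 | 5 => true
    | 6 => h = (8, 8) ∧ 2 ≤ d
    | _ => false

/-- Banker follows the table and stands on `mixedHand d` when Player stands. -/
def bankerStands (d : ℕ) : BankerPure :=
  ⟨bankerSituations.filter fun s => bankerTable d s.1 s.2 = true, Finset.filter_subset _ _⟩

/-- Banker follows the table and draws on `mixedHand d` when Player stands. -/
def bankerDraws (d : ℕ) : BankerPure :=
  ⟨bankerSituations.filter fun s => bankerTable d s.1 s.2 = true ∨ s = (mixedHand d, none),
    Finset.filter_subset _ _⟩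

/-- The mixed strategy of following the table and drawing on `mixedHand d`, when Player stands,
with probability `q`. -/
noncomputable def bankerMixed (d : ℕ) (q : ℝ) : BankerPure → ℝ :=
  (1 - q) • Pi.single (bankerStands d) 1 + q • Pi.single (bankerDraws d) 1

/-! The constants of the solution for a `d`-deck shoe (`d ≥ 1`). -/

/-- The probability with which Player draws on `(1,4)`. -/
noncomputable def pOpt (d : ℕ) : ℝ :=
  if d = 1 then 1 / 19
  else (12 * d - 1) * (16 * d ^ 2 - 14 * d + 1) / (32 * d ^ 2 * (11 * d - 1))

/-- The probability with which Banker draws on `mixedHand d` when Player stands. -/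
noncomputable def qOpt (d : ℕ) : ℝ :=
  if d = 1 then 4519 / 10716
  else if d = 2 then 17431 / 64512
  else if d = 3 then 4425647 / 11132928
  else if d ≤ 7 then
    (92160 * d ^ 4 - 120128 * d ^ 3 + 26336 * d ^ 2 - 2000 * d + 47) /
      (256 * d ^ 2 * (11 * d - 1) * (52 * d - 5))
  else if d = 8 then 316815305 / 585842688
  else
    (91648 * d ^ 4 - 119488 * d ^ 3 + 26032 * d ^ 2 - 1932 * d + 41) /
      (256 * d ^ 2 * (11 * d - 1) * (52 * d - 5))

/-- The value of the game (to Player). -/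
noncomputable def vOpt (d : ℕ) : ℝ :=
  if d = 1 then -37833961 / 2901089100
  else if d = 2 then -49424010137 / 3823801581600
  else if d = 3 then -31717439249 / 2461444457472
  else if d ≤ 7 then
    -2 * (1390665728 * d ^ 7 - 491115520 * d ^ 6 + 50698240 * d ^ 5 + 2428032 * d ^ 4
        - 990512 * d ^ 3 + 89192 * d ^ 2 - 3462 * d + 47) /
      ((11 * d - 1) * ((52 * d).descFactorial 6 : ℕ))
  else if d = 8 then -2789416947665657 / 217430324984396160
  else
    -2 * (1391755264 * d ^ 7 - 500535296 * d ^ 6 + 54174464 * d ^ 5 + 1931136 * d ^ 4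
        - 948816 * d ^ 3 + 85792 * d ^ 2 - 3238 * d + 41) /
      ((11 * d - 1) * ((52 * d).descFactorial 6 : ℕ))

end Baccara

/-! The strategies are given, so only their optimality has to be verified. If Player's mixture
secures `v` against every pure strategy of Banker, and Banker's mixture holds every pure strategy of
Player to the same `v`, then both are optimal and `v` is the value.

The strategy sets are huge, but the payoff decouples. Multiplied by `(52d)_6` it is a sum over deals
of six cards, weighted by a product of card counts that does not depend on the order of the cards
(`ways_perm`). Deals with a natural cancel when the two hands are exchanged. If Player's cards are
regarded as dealt last, the payoff against a fixed mixture of Player is a sum over Banker's 484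
situations, affine in the drawing probability in each. A best reply is therefore recognized
situation by situation (`BankerOptimal`). Likewise, against a fixed mixture of Banker, the payoff is
a sum over Player's hands, and only the sign of `drawGain` on the five hands with total 5 matters
(`PlayerOptimal`). The probability `p` makes Banker indifferent on `mixedHand` when Player stands,
and `q` makes Player indifferent on `(1,4)`. By the first indifference the payoff of the two
mixtures does not depend on `q`, so the value is computed with Banker standing on `mixedHand`.

What remains are numerical comparisons. After denominators are cleared and two is added to every
score, all quantities are natural numbers. For `d = 1` they are evaluated directly. For `d = t + s`
with `s ≥ 2` they are polynomials in `t` with natural coefficients, and coefficientwise comparison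
suffices for an inequality for all `t`. The coefficients are the digits of the value at one large
argument, so each test evaluates two functions at numerals (`NatPoly.le_of_polyLe`). Situations in
which Banker's table agrees for all `d ≥ 2` are settled by a polynomial test from 2 on. The others
are tested for each `d` from 2 to 8 and by a polynomial test from 9 on. Player's decisions and the
value are also split at 9.

The game with replacement is the limit `d → ∞`: payoffs and strategies converge, and the
inequalities that express optimality pass to the limit. -/

namespace MatrixGame

/-! ### Optimality of mixed strategies in matrix games. -/

variable {m n : Type} [Fintype m] [Fintype n] {A : m → n → ℝ} {p : m → ℝ} {q : n → ℝ} {v : ℝ}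

theorem rowGuarantees_of_forall_pure (hp : p ∈ stdSimplex ℝ m) (h : ∀ j, v ≤ ∑ i, p i * A i j) :
    RowGuarantees A p v := by
  refine ⟨hp, fun q hq => ?_⟩
  have : expected A p q = ∑ j, q j * ∑ i, p i * A i j := by
    unfold expected
    rw [Finset.sum_comm]
    refine Finset.sum_congr rfl fun j _ => ?_
    rw [Finset.mul_sum]
    exact Finset.sum_congr rfl fun i _ => by ring
  rw [this]
  calc v = ∑ j, q j * v := by rw [← Finset.sum_mul, hq.2, one_mul]
    _ ≤ _ := Finset.sum_le_sum fun j _ => mul_le_mul_of_nonneg_left (h j) (hq.1 j)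

theorem colGuarantees_of_forall_pure (hq : q ∈ stdSimplex ℝ n) (h : ∀ i, ∑ j, q j * A i j ≤ v) :
    ColGuarantees A q v := by
  refine ⟨hq, fun p hp => ?_⟩
  have : expected A p q = ∑ i, p i * ∑ j, q j * A i j := by
    unfold expected
    refine Finset.sum_congr rfl fun i _ => ?_
    rw [Finset.mul_sum]
    exact Finset.sum_congr rfl fun j _ => by ring
  rw [this]
  calc _ ≤ ∑ i, p i * v := Finset.sum_le_sum fun i _ => mul_le_mul_of_nonneg_left (h i) (hp.1 i)
    _ = v := by rw [← Finset.sum_mul, hp.2, one_mul]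

/-- Weak duality: whatever one side guarantees is bounded by what the other side concedes, so two
guarantees that meet at `v` pin down the value. -/
theorem isSolution_of_guarantees (hp : RowGuarantees A p v) (hq : ColGuarantees A q v) :
    IsSolution A p q v := by
  refine ⟨⟨⟨⟨p, hp⟩, ?_⟩, ⟨q, hq⟩, ?_⟩, hp, hq⟩
  · rintro w ⟨p', hp'⟩
    exact (hp'.2 q hq.1).trans (hq.2 p' hp'.1)
  · rintro w ⟨q', hq'⟩
    exact (hp.2 q' hq'.1).trans (hq'.2 p hp.1)

theorem twoPoint_mem_stdSimplex [DecidableEq m] {a : ℝ} (h0 : 0 ≤ a) (h1 : a ≤ 1) (i j : m) :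
    ((1 - a) • Pi.single i 1 + a • Pi.single j 1 : m → ℝ) ∈ stdSimplex ℝ m :=
  convex_stdSimplex ℝ m (single_mem_stdSimplex ℝ i) (single_mem_stdSimplex ℝ j)
    (by linarith) h0 (by ring)

theorem sum_twoPoint_mul [DecidableEq m] (a : ℝ) (i j : m) (f : m → ℝ) :
    ∑ k, ((1 - a) • Pi.single i 1 + a • Pi.single j 1 : m → ℝ) k * f k
      = (1 - a) * f i + a * f j := by
  simp [add_mul, Finset.sum_add_distrib, Pi.single_apply, ite_mul, mul_ite]

end MatrixGame

namespace Baccara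

/-! ### Cards as numbers -/

/-- The number of cards of value `v` in a single deck. -/
def copies (v : ℕ) : ℕ := bif Nat.beq v 0 then 16 else 4

/-- The number of occurrences of `v` in a list. -/
def occ (v : ℕ) : List ℕ → ℕ
  | [] => 0
  | a :: l => bif Nat.beq a v then Nat.succ (occ v l) else occ v l

theorem occ_eq_count (v : ℕ) (L : List ℕ) : occ v L = L.count v := by
  induction L with
  | nil => rfl
  | cons a l ih =>
    rw [occ, List.count_cons, ih]
    by_cases h : a = v
    · simp [h, Nat.beq_refl]
    · simp [h, show Nat.beq a v = false from Bool.eq_false_iff.2 fun e => h (Nat.eq_of_beq_eq_true e)]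

theorem occ_cons (v a : ℕ) (L : List ℕ) : occ v (a :: L) = occ v L + if a = v then 1 else 0 := by
  simp only [occ_eq_count, List.count_cons]
  simp

theorem occ_le_length (v : ℕ) (L : List ℕ) : occ v L ≤ L.length := by
  rw [occ_eq_count]; exact List.count_le_length

/-- The number of cards of value `v` left in a `d`-deck shoe without the cards in `L`. -/
noncomputable def left (d : ℝ) (L : List ℕ) (v : ℕ) : ℝ := copies v * d - occ v L

/-- The product of the numbers of cards left when the cards in a list are dealt, the last one
first. -/
noncomputable def ways (d : ℝ) : List ℕ → ℝ
  | [] => 1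
  | v :: L => left d L v * ways d L

theorem left_perm {d : ℝ} {L L' : List ℕ} (h : L.Perm L') (v : ℕ) : left d L v = left d L' v := by
  rw [left, left, occ_eq_count, occ_eq_count, h.count_eq]

/-- Cards dealt without replacement are exchangeable. It is enough to exchange two adjacent cards,
where either the values agree or neither count affects the other. -/
theorem ways_perm {d : ℝ} {L L' : List ℕ} (h : L.Perm L') : ways d L = ways d L' := by
  induction h with
  | nil => rfl
  | cons x h ih => rw [ways, ways, ih, left_perm h]
  | swap x y l =>
    simp only [ways, left, occ_cons]
    by_cases hxy : x = y
    · subst hxy; ring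
    · simp [hxy, Ne.symm hxy]; ring
  | trans _ _ h1 h2 => rw [h1, h2]

/-- A deck has at least four cards of each value, so four known cards cannot exhaust more than there
are. The bound 4 is sharp for `d = 1`. -/
theorem left_nonneg {d : ℕ} {L : List ℕ} (hd : 1 ≤ d) (hL : L.length ≤ 4) (v : ℕ) :
    0 ≤ left d L v := by
  have h1 : occ v L ≤ 4 := (occ_le_length v L).trans hL
  have h2 : 4 ≤ copies v := by unfold copies; cases Nat.beq v 0 <;> simp
  have h3 : (occ v L : ℝ) ≤ 4 := by exact_mod_cast h1
  have h4 : (4 : ℝ) ≤ copies v * d := by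
    exact_mod_cast Nat.le_trans (by omega) (Nat.mul_le_mul h2 hd)
  unfold left; linarith

theorem ways_nonneg {d : ℕ} (hd : 1 ≤ d) {L : List ℕ} (hL : L.length ≤ 5) : 0 ≤ ways d L := by
  induction L with
  | nil => simp [ways]
  | cons v L ih =>
    simp only [List.length_cons] at hL
    exact mul_nonneg (left_nonneg hd (by omega) v) (ih (by omega))

theorem sum_occ (L : List CardValue) :
    ∑ v : CardValue, (occ v.val (L.map Fin.val) : ℝ) = L.length := by
  induction L with
  | nil => simp [occ]
  | cons a l ih =>
    simp only [List.map_cons, occ_cons, Nat.cast_add, Finset.sum_add_distrib, ih, List.length_cons]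
    simp [Fin.val_inj]

theorem sum_left (d : ℝ) (L : List CardValue) :
    ∑ v : CardValue, left d (L.map Fin.val) v.val = 52 * d - L.length := by
  simp only [left, Finset.sum_sub_distrib, sum_occ, ← Finset.sum_mul]
  have h : ∑ v : CardValue, copies v.val = 52 := by decide
  rw [← Nat.cast_sum, h]
  norm_num

theorem shoe_eq (d : ℕ) (L : List CardValue) (v : CardValue) :
    shoe d L v = left d (L.map Fin.val) v.val / (52 * d - L.length) := by
  have h : ∀ v, deckCount v = copies v.val := by decide
  rw [shoe, left, occ_eq_count, h v, List.count_map_of_injective _ _ Fin.val_injective, mul_comm]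


/-! ### The payoff as a sum over deals of six cards. -/

/-- The total of two cards. -/
def pairTotal (x : Hand) : ℕ := (x.1.val + x.2.val) % 10

theorem total_pair (a b : CardValue) : total [a, b] = pairTotal (a, b) := by
  simp [total, pairTotal]

theorem total_triple (a b c : CardValue) : total [a, b, c] = (pairTotal (a, b) + c.val) % 10 := by
  simp [total, pairTotal, add_assoc]

theorem pairTotal_lt (x : Hand) : pairTotal x < 10 := Nat.mod_lt _ (by norm_num)

/-- The hand formed by an ordered pair of cards. -/
def handOf (x : Hand) : Hand := mkHand x.1 x.2

/-- Player's conditional expected profit, given Player's cards `x`, Banker's cards `y`, and the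
next two cards `k` and `l`, when Player draws on the hand `h` with probability `a h` and Banker
draws in the situation `(h, k)` with probability `b h k`. -/
noncomputable def outcome (a : Hand → ℝ) (b : Hand → Option CardValue → ℝ) (x y : Hand)
    (k l : CardValue) : ℝ :=
  if 8 ≤ pairTotal x ∨ 8 ≤ pairTotal y then score (pairTotal x) (pairTotal y)
  else
    a (handOf x) *
      (b (handOf y) (some k) *
          score ((pairTotal x + k.val) % 10) ((pairTotal y + l.val) % 10) +
        (1 - b (handOf y) (some k)) * score ((pairTotal x + k.val) % 10) (pairTotal y)) +
    (1 - a (handOf x)) *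
      (b (handOf y) none * score (pairTotal x) ((pairTotal y + k.val) % 10) +
        (1 - b (handOf y) none) * score (pairTotal x) (pairTotal y))

/-- The expected profit times the number of ways in which six cards can be dealt. -/
noncomputable def scaledPayoff (d : ℝ) (a : Hand → ℝ) (b : Hand → Option CardValue → ℝ) : ℝ :=
  ∑ x : Hand, ∑ y : Hand, ∑ k : CardValue, ∑ l : CardValue,
    ways d [l.val, k.val, y.2.val, y.1.val, x.2.val, x.1.val] * outcome a b x y k l

noncomputable def playerProb (S : PlayerPure) (h : Hand) : ℝ := if h ∈ S.1 then 1 else 0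

noncomputable def bankerProb (T : BankerPure) (h : Hand) (k : Option CardValue) : ℝ :=
  if (h, k) ∈ T.1 then 1 else 0

/-- The number of ways in which six cards can be dealt from a `d`-deck shoe. -/
noncomputable def sixWays (d : ℝ) : ℝ :=
  (52 * d) * (52 * d - 1) * (52 * d - 2) * (52 * d - 3) * (52 * d - 4) * (52 * d - 5)

theorem sum_shoe {d : ℕ} (hd : 1 ≤ d) {L : List CardValue} (hL : L.length ≤ 5) :
    ∑ v, shoe d L v = 1 := by
  simp only [shoe_eq, ← Finset.sum_div, sum_left]
  have h1 : (1 : ℝ) ≤ d := by exact_mod_cast hd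
  have h2 : (L.length : ℝ) ≤ 5 := by exact_mod_cast hL
  exact div_self (by linarith)

/-- Two further cards `k` and `l` are dealt in every case, and those that are not used average out
because the conditional probabilities sum to one. When Player stands, Banker's third card is `k`. -/
theorem profit_eq {d : ℕ} (hd : 1 ≤ d) (S : PlayerPure) (T : BankerPure) (x y : Hand) :
    profit (shoe d) S T x.1 x.2 y.1 y.2 =
      ∑ k, ∑ l, shoe d [x.1, x.2, y.1, y.2] k * shoe d [x.1, x.2, y.1, y.2, k] l *
        outcome (playerProb S) (bankerProb T) x y k l := by
  obtain ⟨x₁, x₂⟩ := x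
  obtain ⟨y₁, y₂⟩ := y
  have h4 : ∀ c : ℝ, ∑ k, shoe d [x₁, x₂, y₁, y₂] k * c = c := fun c => by
    rw [← Finset.sum_mul, sum_shoe hd (by simp), one_mul]
  have h5 : ∀ (k : CardValue) (c : ℝ), ∑ l, shoe d [x₁, x₂, y₁, y₂, k] l * c = c := fun k c => by
    rw [← Finset.sum_mul, sum_shoe hd (by simp), one_mul]
  simp only [mul_assoc, ← Finset.mul_sum]
  have hx : handOf (x₁, x₂) = mkHand x₁ x₂ := rfl
  have hy : handOf (y₁, y₂) = mkHand y₁ y₂ := rfl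
  simp only [profit, outcome, total_pair, total_triple, hx, hy]
  simp only [playerProb, bankerProb]
  split_ifs <;> simp only [h4, h5, one_mul, zero_mul, sub_self, sub_zero, add_zero, zero_add]
  all_goals
    refine Finset.sum_congr rfl fun k _ => ?_
    split_ifs <;> simp only [h5, one_mul, zero_mul, sub_self, sub_zero, add_zero, zero_add]

/-- The denominators of the six conditional probabilities do not depend on the cards. Their product
is `sixWays d`, and the product of the numerators is `ways`. -/
theorem sixWays_mul_payoff {d : ℕ} (hd : 1 ≤ d) (S : PlayerPure) (T : BankerPure) :
    sixWays d * payoff (shoe d) S T = scaledPayoff d (playerProb S) (bankerProb T) := by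
  have h1 : (1 : ℝ) ≤ d := by exact_mod_cast hd
  have e0 : 52 * (d : ℝ) ≠ 0 := by linarith
  have e1 : 52 * (d : ℝ) - 1 ≠ 0 := by linarith
  have e2 : 52 * (d : ℝ) - 2 ≠ 0 := by linarith
  have e3 : 52 * (d : ℝ) - 3 ≠ 0 := by linarith
  have e4 : 52 * (d : ℝ) - 4 ≠ 0 := by linarith
  have e5 : 52 * (d : ℝ) - 5 ≠ 0 := by linarith
  unfold payoff scaledPayoff
  simp only [Fintype.sum_prod_type, Finset.mul_sum]
  refine Finset.sum_congr rfl fun x₁ _ => Finset.sum_congr rfl fun x₂ _ =>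
    Finset.sum_congr rfl fun y₁ _ => Finset.sum_congr rfl fun y₂ _ => ?_
  rw [profit_eq hd S T (x₁, x₂) (y₁, y₂)]
  simp only [Finset.mul_sum]
  refine Finset.sum_congr rfl fun k _ => Finset.sum_congr rfl fun l _ => ?_
  generalize outcome (playerProb S) (bankerProb T) (x₁, x₂) (y₁, y₂) k l = o
  simp only [shoe_eq, ways, List.map_cons, List.map_nil, List.length_cons, List.length_nil]
  -- `shoe` lists the known cards in the order of the deal, `ways` lists the latest card first.
  rw [left_perm (L := [x₁.val, x₂.val]) (L' := [x₂.val, x₁.val]) (List.Perm.swap ..),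
    left_perm (L := [x₁.val, x₂.val, y₁.val]) (L' := [y₁.val, x₂.val, x₁.val])
      (List.reverse_perm [y₁.val, x₂.val, x₁.val]),
    left_perm (L := [x₁.val, x₂.val, y₁.val, y₂.val]) (L' := [y₂.val, y₁.val, x₂.val, x₁.val])
      (List.reverse_perm [y₂.val, y₁.val, x₂.val, x₁.val]),
    left_perm (L := [x₁.val, x₂.val, y₁.val, y₂.val, k.val])
      (L' := [k.val, y₂.val, y₁.val, x₂.val, x₁.val])
      (List.reverse_perm [k.val, y₂.val, y₁.val, x₂.val, x₁.val])]
  push_cast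
  unfold sixWays
  field_simp
  ring

theorem score_swap (x y : ℕ) : score y x = -score x y := by
  unfold score
  split_ifs <;> first | omega | simp


/-! ### Decomposition of the scaled payoff by Player's hands and by Banker's situations. -/

/-- Player's profit, weighted by the numbers of cards left without `L`, when Player's final total
is `T` and Banker draws to the total `t` with probability `b`. -/
noncomputable def moveMean (b d : ℝ) (L : List ℕ) (T t : ℕ) : ℝ :=
  b * ∑ l : CardValue, left d L l.val * score T ((t + l.val) % 10) +
    (1 - b) * ((52 * d - L.length) * score T t)

/-- Contribution to the scaled payoff of a situation of Banker, who has total `t`, when the known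
cards are `L`, Player holds the hand `h` with weight `a h`, and Player's third card is `k`. -/
noncomputable def situationMean (d : ℝ) (a : Hand → ℝ) (b : ℝ) (L : List ℕ) (k t : ℕ) : ℝ :=
  ∑ x : Hand, if 8 ≤ pairTotal x then 0 else
    a (handOf x) * (left d L x.1.val * left d (x.1.val :: L) x.2.val) *
      moveMean b d (x.2.val :: x.1.val :: L) ((pairTotal x + k) % 10) t

/-- Contribution to the scaled payoff of Player's hand `x` when he draws. -/
noncomputable def drawMean (d : ℝ) (b : Hand → Option CardValue → ℝ) (x : Hand) : ℝ :=
  ∑ y : Hand, if 8 ≤ pairTotal y then 0 else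
    (left d [x.2.val, x.1.val] y.1.val * left d [y.1.val, x.2.val, x.1.val] y.2.val) *
      ∑ k : CardValue, left d [y.2.val, y.1.val, x.2.val, x.1.val] k.val *
        moveMean (b (handOf y) (some k)) d [k.val, y.2.val, y.1.val, x.2.val, x.1.val]
          ((pairTotal x + k.val) % 10) (pairTotal y)

/-- Contribution to the scaled payoff of Player's hand `x` when he stands. -/
noncomputable def standMean (d : ℝ) (b : Hand → Option CardValue → ℝ) (x : Hand) : ℝ :=
  (52 * d - 5) * ∑ y : Hand, if 8 ≤ pairTotal y then 0 else
    (left d [x.2.val, x.1.val] y.1.val * left d [y.1.val, x.2.val, x.1.val] y.2.val) *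
      moveMean (b (handOf y) none) d [y.2.val, y.1.val, x.2.val, x.1.val]
        (pairTotal x) (pairTotal y)

theorem moveMean_perm {L L' : List ℕ} (h : L.Perm L') (b d : ℝ) (T t : ℕ) :
    moveMean b d L T t = moveMean b d L' T t := by
  simp only [moveMean, left_perm h, h.length_eq]

theorem sum_left_five (d : ℝ) (a b c e f : CardValue) :
    ∑ l : CardValue, left d [a.val, b.val, c.val, e.val, f.val] l.val = 52 * d - 5 := by
  have := sum_left d [a, b, c, e, f]
  simpa using this

theorem sum_left_four (d : ℝ) (a b c e : CardValue) :
    ∑ l : CardValue, left d [a.val, b.val, c.val, e.val] l.val = 52 * d - 4 := by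
  have := sum_left d [a, b, c, e]
  simpa using this

/-- If Player stands, at most one more card matters. The idle last card contributes the factor `52 *
d - 5`, the number of cards left after five. -/
theorem sum_ways_mul_outcome (d : ℝ) (a : Hand → ℝ) (b : Hand → Option CardValue → ℝ)
    {x y : Hand} (hx : ¬ 8 ≤ pairTotal x) (hy : ¬ 8 ≤ pairTotal y) :
    ∑ k : CardValue, ∑ l : CardValue,
        ways d [l.val, k.val, y.2.val, y.1.val, x.2.val, x.1.val] * outcome a b x y k l =
      ways d [y.2.val, y.1.val, x.2.val, x.1.val] *
        (a (handOf x) * ∑ k : CardValue, left d [y.2.val, y.1.val, x.2.val, x.1.val] k.val *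
            moveMean (b (handOf y) (some k)) d [k.val, y.2.val, y.1.val, x.2.val, x.1.val]
              ((pairTotal x + k.val) % 10) (pairTotal y) +
          (1 - a (handOf x)) * ((52 * d - 5) *
            moveMean (b (handOf y) none) d [y.2.val, y.1.val, x.2.val, x.1.val]
              (pairTotal x) (pairTotal y))) := by
  have hl : ∀ k : CardValue, ∑ l : CardValue,
      ways d [l.val, k.val, y.2.val, y.1.val, x.2.val, x.1.val] * outcome a b x y k l =
      ways d [y.2.val, y.1.val, x.2.val, x.1.val] *
        (a (handOf x) * (left d [y.2.val, y.1.val, x.2.val, x.1.val] k.val *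
            moveMean (b (handOf y) (some k)) d [k.val, y.2.val, y.1.val, x.2.val, x.1.val]
              ((pairTotal x + k.val) % 10) (pairTotal y)) +
          (1 - a (handOf x)) * ((52 * d - 5) * (left d [y.2.val, y.1.val, x.2.val, x.1.val] k.val *
            (b (handOf y) none * score (pairTotal x) ((pairTotal y + k.val) % 10) +
        (1 - b (handOf y) none) * score (pairTotal x) (pairTotal y))))) := by
    intro k
    -- The factor `52 * d - 5` is written as a sum over the last card, so that both sides can be
    -- compared term by term in `l`.
    rw [← sum_left_five d k y.2 y.1 x.2 x.1]
    simp only [outcome, hx, hy, or_self, if_false, moveMean, ways, List.length_cons,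
      List.length_nil]
    norm_num only
    rw [← sum_left_five d k y.2 y.1 x.2 x.1]
    simp only [Finset.mul_sum, Finset.sum_mul, ← Finset.sum_add_distrib]
    exact Finset.sum_congr rfl fun l _ => by ring
  simp only [hl]
  rw [← Finset.mul_sum, Finset.sum_add_distrib, ← Finset.mul_sum, ← Finset.mul_sum,
    ← Finset.mul_sum]
  congr 4
  simp only [moveMean, List.length_cons, List.length_nil]
  norm_num only
  rw [← sum_left_four d y.2 y.1 x.2 x.1]
  simp only [Finset.mul_sum, Finset.sum_mul, ← Finset.sum_add_distrib]
  exact Finset.sum_congr rfl fun l _ => by ring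

theorem ways_cons_cons (d : ℝ) (i j : ℕ) (L : List ℕ) :
    ways d (i :: j :: L) = left d (j :: L) i * (left d L j * ways d L) := rfl

theorem ways_swap (d : ℝ) (x y : Hand) (k l : CardValue) :
    ways d [l.val, k.val, y.2.val, y.1.val, x.2.val, x.1.val] =
      ways d [l.val, k.val, x.2.val, x.1.val, y.2.val, y.1.val] := by
  refine ways_perm (List.Perm.cons _ (List.Perm.cons _ ?_))
  exact List.perm_append_comm (l₁ := [y.2.val, y.1.val]) (l₂ := [x.2.val, x.1.val])

/-- The naturals contribute nothing, by symmetry. -/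
theorem scaledPayoff_eq_sum (d : ℝ) (a : Hand → ℝ) (b : Hand → Option CardValue → ℝ) :
    scaledPayoff d a b = ∑ x : Hand, ∑ y : Hand,
      if 8 ≤ pairTotal x ∨ 8 ≤ pairTotal y then 0 else ∑ k : CardValue, ∑ l : CardValue,
        ways d [l.val, k.val, y.2.val, y.1.val, x.2.val, x.1.val] * outcome a b x y k l := by
  -- This is the contribution of the deals with a natural. Exchanging the hands keeps the weight and
  -- negates the score, so `f` is antisymmetric and its double sum vanishes.
  let f : Hand → Hand → ℝ := fun x y => if 8 ≤ pairTotal x ∨ 8 ≤ pairTotal y then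
    ∑ k : CardValue, ∑ l : CardValue,
      ways d [l.val, k.val, y.2.val, y.1.val, x.2.val, x.1.val] * score (pairTotal x) (pairTotal y)
    else 0
  have hanti : ∀ x y, f y x = -f x y := by
    intro x y
    by_cases h : 8 ≤ pairTotal x ∨ 8 ≤ pairTotal y
    · change ite _ _ _ = -ite _ _ _
      rw [if_pos h, if_pos h.symm, ← Finset.sum_neg_distrib]
      refine Finset.sum_congr rfl fun k _ => ?_
      rw [← Finset.sum_neg_distrib]
      refine Finset.sum_congr rfl fun l _ => ?_
      rw [ways_swap, score_swap, mul_neg]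
    · change ite _ _ _ = -ite _ _ _
      rw [if_neg h, if_neg (mt Or.symm h), neg_zero]
  have hzero : ∑ x, ∑ y, f x y = 0 := by
    have h1 : ∑ x, ∑ y, f x y = ∑ x, ∑ y, -f x y := by
      rw [Finset.sum_comm]
      exact Finset.sum_congr rfl fun x _ => Finset.sum_congr rfl fun y _ => hanti x y
    simp only [Finset.sum_neg_distrib] at h1
    linarith
  suffices h : scaledPayoff d a b = ∑ x, ∑ y, f x y + _ by rw [h, hzero, zero_add]
  rw [scaledPayoff, ← Finset.sum_add_distrib]
  refine Finset.sum_congr rfl fun x _ => ?_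
  rw [← Finset.sum_add_distrib]
  refine Finset.sum_congr rfl fun y _ => ?_
  by_cases h : 8 ≤ pairTotal x ∨ 8 ≤ pairTotal y
  · simp only [f, h, if_true, add_zero, outcome]
  · simp only [f, h, if_false, zero_add]

/-- The scaled payoff as a sum over Player's hands. -/
theorem scaledPayoff_eq_sum_player (d : ℝ) (a : Hand → ℝ) (b : Hand → Option CardValue → ℝ) :
    scaledPayoff d a b = ∑ x : Hand, if 8 ≤ pairTotal x then 0 else
      ways d [x.2.val, x.1.val] *
        (a (handOf x) * drawMean d b x + (1 - a (handOf x)) * standMean d b x) := by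
  rw [scaledPayoff_eq_sum]
  refine Finset.sum_congr rfl fun x _ => ?_
  by_cases hx : 8 ≤ pairTotal x
  · simp [hx]
  · simp only [hx, false_or, if_false, drawMean, standMean]
    rw [Finset.mul_sum, Finset.mul_sum, Finset.mul_sum, ← Finset.sum_add_distrib, Finset.mul_sum]
    refine Finset.sum_congr rfl fun y _ => ?_
    by_cases hy : 8 ≤ pairTotal y
    · simp [hy]
    · simp only [hy, if_false, sum_ways_mul_outcome d a b hx hy]
      rw [ways_cons_cons d y.2.val]
      ring

/-- The scaled payoff as a sum over the situations of Banker. -/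
theorem scaledPayoff_eq_sum_banker (d : ℝ) (a : Hand → ℝ) (b : Hand → Option CardValue → ℝ) :
    scaledPayoff d a b = ∑ y : Hand, if 8 ≤ pairTotal y then 0 else
      (∑ k : CardValue, ways d [k.val, y.2.val, y.1.val] *
        situationMean d a (b (handOf y) (some k)) [k.val, y.2.val, y.1.val] k.val (pairTotal y)) +
      (52 * d - 5) * ways d [y.2.val, y.1.val] *
        situationMean d (fun h => 1 - a h) (b (handOf y) none) [y.2.val, y.1.val] 0
          (pairTotal y) := by
  rw [scaledPayoff_eq_sum, Finset.sum_comm]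
  refine Finset.sum_congr rfl fun y _ => ?_
  by_cases hy : 8 ≤ pairTotal y
  · simp [hy]
  simp only [hy, or_false, if_false, situationMean, Finset.mul_sum]
  rw [Finset.sum_comm, ← Finset.sum_add_distrib]
  refine Finset.sum_congr rfl fun x _ => ?_
  by_cases hx : 8 ≤ pairTotal x
  · simp [hx]
  simp only [hx, if_false, sum_ways_mul_outcome d a b hx hy, mul_add, Finset.mul_sum]
  congr 1
  · refine Finset.sum_congr rfl fun k _ => ?_
    -- Banker's situation consists of `y` and `k`; by exchangeability Player's cards `x` may be
    -- regarded as dealt after them.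
    have hp : [k.val, y.2.val, y.1.val, x.2.val, x.1.val].Perm
        [x.2.val, x.1.val, k.val, y.2.val, y.1.val] :=
      List.perm_append_comm (l₁ := [k.val, y.2.val, y.1.val]) (l₂ := [x.2.val, x.1.val])
    have hw := ways_perm (d := d) hp
    rw [moveMean_perm hp]
    rw [ways, ways_cons_cons d x.2.val] at hw
    linear_combination (a (handOf x) * moveMean (b (handOf y) (some k)) d
      [x.2.val, x.1.val, k.val, y.2.val, y.1.val] ((pairTotal x + k.val) % 10) (pairTotal y)) * hw
  · have hp : [y.2.val, y.1.val, x.2.val, x.1.val].Perm [x.2.val, x.1.val, y.2.val, y.1.val] :=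
      List.perm_append_comm (l₁ := [y.2.val, y.1.val]) (l₂ := [x.2.val, x.1.val])
    have hw := ways_perm (d := d) hp
    rw [moveMean_perm hp, add_zero, Nat.mod_eq_of_lt (pairTotal_lt x)]
    rw [ways_cons_cons d x.2.val] at hw
    linear_combination ((1 - a (handOf x)) * (52 * d - 5) * moveMean (b (handOf y) none) d
      [x.2.val, x.1.val, y.2.val, y.1.val] (pairTotal x) (pairTotal y)) * hw


/-! ### Evaluation in natural numbers

Two is added to every score, so that all quantities are natural numbers. -/

/-- The score plus two. -/
def scoreShift (x y : ℕ) : ℕ := bif Nat.blt y x then 3 else bif Nat.blt x y then 1 else 2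

/-- The shifted score when Banker, who has total `t`, draws the card `a`. -/
def drawScore (T t a : ℕ) : ℕ := scoreShift T (Nat.mod (Nat.add t a) 10)

/-- The sum of `drawScore` over a list of cards. -/
def drawScoreSum (T t : ℕ) : List ℕ → ℕ
  | [] => 0
  | a :: l => Nat.add (drawScore T t a) (drawScoreSum T t l)

/-- The sum of `drawScore` over one deck. -/
def deckScore (T t : ℕ) : ℕ := Nat.add 44 (Nat.add (Nat.mul 8 T) (Nat.mul 12 (scoreShift T t)))

/-- The sum of the shifted scores over the next card when `n` cards `L` have been dealt. -/
def moveScore (b : Bool) (d n T t : ℕ) (L : List ℕ) : ℕ :=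
  bif b then Nat.sub (Nat.mul (deckScore T t) d) (drawScoreSum T t L)
  else Nat.mul (scoreShift T t) (Nat.sub (Nat.mul 52 d) n)

/-- The number of cards of value `v` left. -/
def cardsLeft (d : ℕ) (L : List ℕ) (v : ℕ) : ℕ := Nat.sub (Nat.mul (copies v) d) (occ v L)

/-- The number of ways in which two cards form a hand. -/
def handWays (d : ℕ) (L : List ℕ) (i j : ℕ) : ℕ :=
  bif Nat.beq i j then Nat.mul (cardsLeft d L i) (Nat.sub (cardsLeft d L i) 1)
  else Nat.mul 2 (Nat.mul (cardsLeft d L i) (cardsLeft d L j))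

/-- A weighted sum over hands, listed as `(total, card, card)`. -/
def handSum (d : ℕ) (L : List ℕ) (f : ℕ → ℕ → ℕ → ℕ) : List (ℕ × ℕ × ℕ) → ℕ
  | [] => 0
  | (t, i, j) :: l => Nat.add (Nat.mul (handWays d L i j) (f t i j)) (handSum d L f l)

/-- The hands on which Player draws. -/
def drawHands : List (ℕ × ℕ × ℕ) :=
  [(0, 0, 0), (0, 1, 9), (0, 2, 8), (0, 3, 7), (0, 4, 6), (0, 5, 5), (1, 0, 1), (1, 2, 9),
   (1, 3, 8), (1, 4, 7), (1, 5, 6), (2, 0, 2), (2, 1, 1), (2, 3, 9), (2, 4, 8), (2, 5, 7),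
   (2, 6, 6), (3, 0, 3), (3, 1, 2), (3, 4, 9), (3, 5, 8), (3, 6, 7), (4, 0, 4), (4, 1, 3),
   (4, 2, 2), (4, 5, 9), (4, 6, 8), (4, 7, 7), (5, 0, 5), (5, 6, 9), (5, 7, 8)]

/-- The hands on which Player stands, except for naturals. -/
def standHands : List (ℕ × ℕ × ℕ) :=
  [(5, 2, 3), (6, 0, 6), (6, 1, 5), (6, 2, 4), (6, 3, 3), (6, 7, 9), (6, 8, 8), (7, 0, 7),
   (7, 1, 6), (7, 2, 5), (7, 3, 4), (7, 8, 9)]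

/-- The hand on which Player randomizes. -/
def randomHands : List (ℕ × ℕ × ℕ) := [(5, 1, 4)]

/-- The hands that are not naturals. -/
def playHands : List (ℕ × ℕ × ℕ) := drawHands ++ (randomHands ++ standHands)

/-! ### Comparison with the real quantities -/

theorem score_eq (x y : ℕ) : score x y = scoreShift x y - 2 := by
  unfold score scoreShift
  by_cases h1 : y < x
  · have : Nat.blt y x = true := by simpa [Nat.blt_eq] using h1
    simp [h1, this]; norm_num
  · have h1' : Nat.blt y x = false := by
      rw [Bool.eq_false_iff]; simpa [Nat.blt_eq] using h1
    by_cases h2 : x < y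
    · have : Nat.blt x y = true := by simpa [Nat.blt_eq] using h2
      simp [h1, h2, h1', this]; norm_num
    · have h2' : Nat.blt x y = false := by
        rw [Bool.eq_false_iff]; simpa [Nat.blt_eq] using h2
      simp [h1, h2, h1', h2']

theorem scoreShift_mem (x y : ℕ) : 1 ≤ scoreShift x y ∧ scoreShift x y ≤ 3 := by
  unfold scoreShift
  cases Nat.blt y x <;> cases Nat.blt x y <;> simp

theorem drawScoreSum_le (T t : ℕ) (L : List ℕ) : drawScoreSum T t L ≤ 3 * L.length := by
  induction L with
  | nil => simp [drawScoreSum]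
  | cons a l ih =>
    have := (scoreShift_mem T (Nat.mod (Nat.add t a) 10)).2
    simp only [drawScoreSum, drawScore, List.length_cons, Nat.add_eq] at *
    omega

theorem deckScore_ge (T t : ℕ) : 56 ≤ deckScore T t := by
  have := (scoreShift_mem T t).1
  simp only [deckScore, Nat.add_eq, Nat.mul_eq]
  omega

/-- Four cards per deck lead to each of the ten totals, and the twelve additional cards of value 0
leave the total `t`. The first part gives `4 * (3 * T + 2 + (9 - T)) = 44 + 8 * T`. -/
theorem sum_copies_mul_drawScore {T t : ℕ} (hT : T < 10) (ht : t < 10) :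
    ∑ l : CardValue, copies l.val * drawScore T t l.val = deckScore T t := by
  have h : ∀ T t : Fin 10, ∑ l : CardValue, copies l.val * drawScore T.val t.val l.val =
    deckScore T.val t.val := by decide +kernel
  exact h ⟨T, hT⟩ ⟨t, ht⟩

theorem sum_occ_mul (L : List CardValue) (f : ℕ → ℝ) :
    ∑ l : CardValue, (occ l.val (L.map Fin.val) : ℝ) * f l.val = (L.map fun a => f a.val).sum := by
  induction L with
  | nil => simp [occ]
  | cons a l ih =>
    simp only [List.map_cons, occ_cons, Nat.cast_add, add_mul, Finset.sum_add_distrib, ih,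
      List.sum_cons]
    rw [add_comm]
    congr 1
    simp [Fin.val_inj]

theorem drawScoreSum_eq (T t : ℕ) (L : List CardValue) :
    (drawScoreSum T t (L.map Fin.val) : ℝ) = (L.map fun a => (drawScore T t a.val : ℝ)).sum := by
  induction L with
  | nil => simp [drawScoreSum]
  | cons a l ih => simp [drawScoreSum, ih]

/-- The shift adds two for each of the `52 * d - n` possible next cards. -/
theorem moveMean_eq {d n T t : ℕ} (hd : 1 ≤ d) (L : List CardValue) (hn : L.length = n)
    (hn5 : n ≤ 5) (hT : T < 10) (ht : t < 10) (b : Bool) :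
    moveMean (if b then 1 else 0) d (L.map Fin.val) T t =
      moveScore b d n T t (L.map Fin.val) - 2 * (52 * d - n) := by
  have hd' : (1 : ℝ) ≤ d := by exact_mod_cast hd
  cases b
  · simp only [moveMean, moveScore, score_eq, List.length_map, hn, cond_false, Nat.mul_eq,
      Nat.sub_eq]
    rw [Nat.cast_mul, Nat.cast_sub (by omega)]
    push_cast
    simp
    ring
  · simp only [moveMean, moveScore, score_eq, cond_true, Nat.mul_eq, Nat.sub_eq]
    -- The natural subtraction in `moveScore` does not truncate: at most five known cards score at
    -- most 3 each, while a deck scores at least 56.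
    have hle : drawScoreSum T t (L.map Fin.val) ≤ deckScore T t * d := by
      have h1 := drawScoreSum_le T t (L.map Fin.val)
      have h2 := deckScore_ge T t
      rw [List.length_map] at h1
      calc _ ≤ 15 := by omega
        _ ≤ deckScore T t * 1 := by omega
        _ ≤ _ := Nat.mul_le_mul_left _ hd
    rw [Nat.cast_sub hle, Nat.cast_mul, ← sum_copies_mul_drawScore hT ht, drawScoreSum_eq,
      ← sum_occ_mul L fun a => (drawScore T t a : ℝ), ← hn, ← sum_left]
    push_cast
    simp only [one_mul, sub_self, zero_mul, add_zero, Finset.sum_mul, Finset.mul_sum,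
      ← Finset.sum_sub_distrib]
    refine Finset.sum_congr rfl fun l _ => ?_
    simp only [left, drawScore, Nat.add_eq]
    have : Nat.mod (t + l.val) 10 = (t + l.val) % 10 := rfl
    rw [this]
    ring

theorem cardsLeft_eq {d : ℕ} (hd : 1 ≤ d) {L : List ℕ} (hL : L.length ≤ 4) (v : ℕ) :
    (cardsLeft d L v : ℝ) = left d L v := by
  have h := left_nonneg hd hL v
  unfold left at h
  have h' : occ v L ≤ copies v * d := by
    have : (occ v L : ℝ) ≤ copies v * d := by linarith
    exact_mod_cast this
  simp only [cardsLeft, Nat.sub_eq, Nat.mul_eq]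
  rw [Nat.cast_sub h', left, Nat.cast_mul]

/-- The number of orders of two cards. -/
def orders (i j : ℕ) : ℝ := if i = j then 1 else 2

theorem handWays_eq {d : ℕ} (hd : 1 ≤ d) {L : List ℕ} (hL : L.length ≤ 3) (i j : ℕ) :
    (handWays d L i j : ℝ) = orders i j * (left d L i * left d (i :: L) j) := by
  unfold handWays orders
  by_cases h : i = j
  · subst h
    -- Nonnegativity after one card `i` has been removed says that at least one such card was left,
    -- so `- 1` in `handWays` is exact. This is why `L` has at most three cards.
    have h0 : 0 ≤ left d (i :: L) i := left_nonneg hd (by simp; omega) i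
    have h1 : left d (i :: L) i = left d L i - 1 := by simp [left, occ_cons]; ring
    have h2 : (1 : ℝ) ≤ cardsLeft d L i := by
      rw [cardsLeft_eq hd (by omega)]; linarith
    have h3 : 1 ≤ cardsLeft d L i := by exact_mod_cast h2
    simp only [Nat.beq_refl, cond_true, Nat.mul_eq, Nat.sub_eq, if_true]
    rw [Nat.cast_mul, Nat.cast_sub h3, cardsLeft_eq hd (by omega), h1]
    simp
  · have h1 : left d (i :: L) j = left d L j := by simp [left, occ_cons, h]
    have h2 : Nat.beq i j = false := Bool.eq_false_iff.2 fun e => h (Nat.eq_of_beq_eq_true e)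
    simp only [h2, cond_false, Nat.mul_eq, h, if_false]
    push_cast
    rw [cardsLeft_eq hd (by omega), cardsLeft_eq hd (by omega), h1]

theorem handSum_eq {d : ℕ} (hd : 1 ≤ d) {L : List ℕ} (hL : L.length ≤ 3) (f : ℕ → ℕ → ℕ → ℕ)
    (l : List (ℕ × ℕ × ℕ)) :
    (handSum d L f l : ℝ) = (l.map fun h => orders h.2.1 h.2.2 *
      (left d L h.2.1 * left d (h.2.1 :: L) h.2.2 * f h.1 h.2.1 h.2.2)).sum := by
  induction l with
  | nil => simp [handSum]
  | cons h l ih =>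
    obtain ⟨t, i, j⟩ := h
    simp only [handSum, List.map_cons, List.sum_cons, ← ih, Nat.add_eq, Nat.mul_eq]
    push_cast
    rw [handWays_eq hd hL]
    ring

set_option maxHeartbeats 1000000 in
/-- A symmetric sum over ordered pairs of cards that are not naturals as a sum over hands. -/
theorem sum_playHands (f : ℕ → ℕ → ℝ) (hf : ∀ i j, f i j = f j i) :
    (∑ x : Hand, if 8 ≤ pairTotal x then 0 else f x.1.val x.2.val) =
      (playHands.map fun h => orders h.2.1 h.2.2 * f h.2.1 h.2.2).sum := by
  have h : ∀ i j, f i j = f (min i j) (max i j) := by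
    intro i j
    rcases le_total i j with h | h
    · rw [min_eq_left h, max_eq_right h]
    · rw [min_eq_right h, max_eq_left h, hf]
  have h' : (∑ x : Hand, if 8 ≤ pairTotal x then 0 else f x.1.val x.2.val) =
      ∑ i : CardValue, ∑ j : CardValue, if 8 ≤ (i.val + j.val) % 10 then 0
        else f (min i.val j.val) (max i.val j.val) := by
    rw [Fintype.sum_prod_type]
    exact Finset.sum_congr rfl fun i _ => Finset.sum_congr rfl fun j _ => by
      rw [← h]; rfl
  rw [h']
  clear h h' hf
  -- The hundred terms are written out; every unordered pair of different values occurs twice.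
  simp [Fin.sum_univ_succ, playHands, drawHands, randomHands, standHands, orders]
  ring


/-! ### Situations of Banker -/

def toCard (n : ℕ) : CardValue := Fin.ofNat 10 n

/-- The hand formed by two cards given as numbers. -/
def natHand (i j : ℕ) : Hand := handOf (toCard i, toCard j)

theorem toCard_val (c : CardValue) : toCard c.val = c := by
  simp [toCard]

theorem val_toCard {n : ℕ} (h : n < 10) : (toCard n).val = n := Nat.mod_eq_of_lt h

theorem natHand_val (x : Hand) : natHand x.1.val x.2.val = handOf x := by
  simp [natHand, toCard_val]

theorem natHand_comm (i j : ℕ) : natHand i j = natHand j i := by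
  simp only [natHand, handOf, mkHand, min_comm, max_comm]

theorem left_mul_left_comm (d : ℝ) (L : List ℕ) (i j : ℕ) :
    left d L i * left d (i :: L) j = left d L j * left d (j :: L) i := by
  by_cases h : i = j
  · rw [h]
  · simp only [left, occ_cons, h, Ne.symm h, if_false, add_zero]; ring

theorem mem_playHands : ∀ h ∈ playHands,
    h.2.1 < 10 ∧ h.2.2 < 10 ∧ (h.2.1 + h.2.2) % 10 = h.1 ∧ h.1 < 8 := by decide

/-- Player's probability of drawing on a hand when he draws on `(1,4)` with probability `p`. -/
noncomputable def playerMix (p : ℝ) (h : Hand) : ℝ :=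
  (1 - p) * playerProb playerStands14 h + p * playerProb playerDraws14 h

theorem playerMix_draw (p : ℝ) : ∀ h ∈ drawHands, playerMix p (natHand h.2.1 h.2.2) = 1 := by
  have : ∀ h ∈ drawHands, natHand h.2.1 h.2.2 ∈ playerStands14.1 ∧
    natHand h.2.1 h.2.2 ∈ playerDraws14.1 := by decide +kernel
  intro h hh
  simp [playerMix, playerProb, this h hh]

theorem playerMix_random (p : ℝ) : ∀ h ∈ randomHands, playerMix p (natHand h.2.1 h.2.2) = p := by
  have : ∀ h ∈ randomHands, natHand h.2.1 h.2.2 ∉ playerStands14.1 ∧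
    natHand h.2.1 h.2.2 ∈ playerDraws14.1 := by decide +kernel
  intro h hh
  simp [playerMix, playerProb, this h hh]

theorem playerMix_stand (p : ℝ) : ∀ h ∈ standHands, playerMix p (natHand h.2.1 h.2.2) = 0 := by
  have : ∀ h ∈ standHands, natHand h.2.1 h.2.2 ∉ playerStands14.1 ∧
    natHand h.2.1 h.2.2 ∉ playerDraws14.1 := by decide +kernel
  intro h hh
  simp [playerMix, playerProb, this h hh]

theorem sum_map_sub {α : Type*} (l : List α) (f g : α → ℝ) :
    (l.map f).sum - (l.map g).sum = (l.map fun a => f a - g a).sum := by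
  induction l with
  | nil => simp
  | cons a l ih => simp only [List.map_cons, List.sum_cons, ← ih]; ring

/-- The shifted score summed over hands of Player and the next card. -/
def moveSum (b : Bool) (d : ℕ) (L : List ℕ) (n k t : ℕ) (hs : List (ℕ × ℕ × ℕ)) : ℕ :=
  handSum d L (fun s i j => moveScore b d n (Nat.mod (Nat.add s k) 10) t (j :: i :: L)) hs

/-- The part of `moveSum` that is due to the shift. -/
def shiftSum (d : ℕ) (L : List ℕ) (n : ℕ) (hs : List (ℕ × ℕ × ℕ)) : ℕ :=
  handSum d L (fun _ _ _ => Nat.mul 2 (Nat.sub (Nat.mul 52 d) n)) hs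

/-- Player's weight is constant on each of the three lists of hands, so a situation is described by
three integer sums and their shifts. -/
theorem situationMean_eq {d : ℕ} (hd : 1 ≤ d) (a : Hand → ℝ) (b : Bool) (L : List CardValue)
    {n : ℕ} (hn : L.length + 2 = n) (hn5 : n ≤ 5) (k : ℕ) {t : ℕ} (ht : t < 10) {u v w : ℝ}
    (hu : ∀ h ∈ drawHands, a (natHand h.2.1 h.2.2) = u)
    (hv : ∀ h ∈ randomHands, a (natHand h.2.1 h.2.2) = v)
    (hw : ∀ h ∈ standHands, a (natHand h.2.1 h.2.2) = w) :
    situationMean d a (if b then 1 else 0) (L.map Fin.val) k t =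
      u * (moveSum b d (L.map Fin.val) n k t drawHands -
        shiftSum d (L.map Fin.val) n drawHands) +
      v * (moveSum b d (L.map Fin.val) n k t randomHands -
        shiftSum d (L.map Fin.val) n randomHands) +
      w * (moveSum b d (L.map Fin.val) n k t standHands -
        shiftSum d (L.map Fin.val) n standHands) := by
  have hd' : (1 : ℝ) ≤ d := by exact_mod_cast hd
  have hL : (L.map Fin.val).length ≤ 3 := by rw [List.length_map]; omega
  have hpart : ∀ (hs : List (ℕ × ℕ × ℕ)) (c : ℝ), (∀ h ∈ hs, h ∈ playHands) →
      (∀ h ∈ hs, a (natHand h.2.1 h.2.2) = c) →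
      (hs.map fun h => orders h.2.1 h.2.2 * (a (natHand h.2.1 h.2.2) *
        (left d (L.map Fin.val) h.2.1 * left d (h.2.1 :: L.map Fin.val) h.2.2) *
        moveMean (if b then 1 else 0) d (h.2.2 :: h.2.1 :: L.map Fin.val)
          (((h.2.1 + h.2.2) % 10 + k) % 10) t)).sum =
      c * (moveSum b d (L.map Fin.val) n k t hs - shiftSum d (L.map Fin.val) n hs) := by
    intro hs c hmem hc
    rw [moveSum, shiftSum, handSum_eq hd hL, handSum_eq hd hL, mul_sub, ← List.sum_map_mul_left,
      ← List.sum_map_mul_left, sum_map_sub]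
    refine congrArg List.sum (List.map_congr_left fun h hh => ?_)
    obtain ⟨h1, h2, h3, h4⟩ := mem_playHands h (hmem h hh)
    have hmap : h.2.2 :: h.2.1 :: L.map Fin.val =
        (toCard h.2.2 :: toCard h.2.1 :: L).map Fin.val := by
      simp only [List.map_cons, val_toCard h1, val_toCard h2]
    rw [hc h hh, h3, hmap, moveMean_eq hd _ (n := n) (by simpa using hn) hn5
      (Nat.mod_lt _ (by norm_num)) ht, ← hmap]
    have e : ((Nat.mul 2 (Nat.sub (Nat.mul 52 d) n) : ℕ) : ℝ) = 2 * (52 * d - n) := by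
      rw [Nat.mul_eq, Nat.sub_eq, Nat.mul_eq, Nat.cast_mul, Nat.cast_sub (by omega)]
      push_cast; ring
    rw [e]
    have e2 : Nat.mod (Nat.add h.1 k) 10 = (h.1 + k) % 10 := rfl
    rw [e2]
    ring
  rw [← hpart drawHands u (fun h hh => by simp [playHands, hh]) hu,
    ← hpart randomHands v (fun h hh => by simp [playHands, hh]) hv,
    ← hpart standHands w (fun h hh => by simp [playHands, hh]) hw, add_assoc,
    ← List.sum_append, ← List.map_append, ← List.sum_append, ← List.map_append]
  have := sum_playHands (fun i j => a (natHand i j) *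
        (left d (L.map Fin.val) i * left d (i :: L.map Fin.val) j) *
        moveMean (if b then 1 else 0) d (j :: i :: L.map Fin.val)
          (((i + j) % 10 + k) % 10) t) (fun i j => by
    rw [natHand_comm, left_mul_left_comm, moveMean_perm (List.Perm.swap i j _), add_comm i j])
  rw [playHands] at this
  rw [← this, situationMean]
  simp only [natHand_val]
  rfl

/-- The contribution to the scaled payoff of a situation, when Banker draws with probability `b`. -/
noncomputable def situationPayoff (d p b : ℝ) (y : Hand) : Option CardValue → ℝ
  | some k => situationMean d (playerMix p) b [k.val, y.2.val, y.1.val] k.val (pairTotal y)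
  | none => situationMean d (fun h => 1 - playerMix p h) b [y.2.val, y.1.val] 0 (pairTotal y)

/-- The shifted version of `situationPayoff` in natural numbers, for `p = m / e`
and `r = e - m`, times `e`. -/
def situationScore (d m e r : ℕ) (b : Bool) (y₁ y₂ : ℕ) : Option ℕ → ℕ
  | some k => Nat.add
      (Nat.mul e (moveSum b d [k, y₂, y₁] 5 k (Nat.mod (Nat.add y₁ y₂) 10) drawHands))
      (Nat.mul m (moveSum b d [k, y₂, y₁] 5 k (Nat.mod (Nat.add y₁ y₂) 10) randomHands))
  | none => Nat.add
      (Nat.mul e (moveSum b d [y₂, y₁] 4 0 (Nat.mod (Nat.add y₁ y₂) 10) standHands))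
      (Nat.mul r
        (moveSum b d [y₂, y₁] 4 0 (Nat.mod (Nat.add y₁ y₂) 10) randomHands))

/-- The part of `situationScore` that is due to the shift. -/
def situationShift (d m e r : ℕ) (y₁ y₂ : ℕ) : Option ℕ → ℕ
  | some k => Nat.add (Nat.mul e (shiftSum d [k, y₂, y₁] 5 drawHands))
      (Nat.mul m (shiftSum d [k, y₂, y₁] 5 randomHands))
  | none => Nat.add (Nat.mul e (shiftSum d [y₂, y₁] 4 standHands))
      (Nat.mul r (shiftSum d [y₂, y₁] 4 randomHands))

/-- When Player draws, his standing hands have weight zero; when he stands, his drawing hands do,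
and `(1,4)` has weight `1 - p`. Multiplication by `e` clears `p = m / e`, and the separate `r = e -
m` avoids a subtraction. -/
theorem situationPayoff_eq {d m e r : ℕ} (hd : 1 ≤ d) (hr : m + r = e) {p : ℝ} (hp : e * p = m)
    (b : Bool) (y : Hand) (k : Option CardValue) :
    e * situationPayoff d p (if b then 1 else 0) y k =
      situationScore d m e r b y.1.val y.2.val (k.map Fin.val) -
        situationShift d m e r y.1.val y.2.val (k.map Fin.val) := by
  cases k with
  | some k =>
    have h := situationMean_eq hd (playerMix p) b [k, y.2, y.1] (n := 5) rfl le_rfl k.val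
      (pairTotal_lt y) (playerMix_draw p) (playerMix_random p) (playerMix_stand p)
    simp only [List.map_cons, List.map_nil] at h
    change e * situationMean d (playerMix p) (if b then 1 else 0) [k.val, y.2.val, y.1.val] k.val
      (pairTotal y) =
      ((e * moveSum b d [k.val, y.2.val, y.1.val] 5 k.val (pairTotal y) drawHands +
        m * moveSum b d [k.val, y.2.val, y.1.val] 5 k.val (pairTotal y) randomHands : ℕ) : ℝ) -
      ((e * shiftSum d [k.val, y.2.val, y.1.val] 5 drawHands +
        m * shiftSum d [k.val, y.2.val, y.1.val] 5 randomHands : ℕ) : ℝ)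
    rw [h, Nat.cast_add, Nat.cast_add, Nat.cast_mul, Nat.cast_mul, Nat.cast_mul, Nat.cast_mul, ← hp]
    ring
  | none =>
    have h := situationMean_eq hd (fun h => 1 - playerMix p h) b [y.2, y.1] (n := 4) rfl
      (by norm_num) 0 (pairTotal_lt y) (u := 0) (v := 1 - p) (w := 1)
      (fun h hh => by simp only [playerMix_draw p h hh, sub_self])
      (fun h hh => by simp only [playerMix_random p h hh])
      (fun h hh => by simp only [playerMix_stand p h hh, sub_zero])
    simp only [List.map_cons, List.map_nil] at h
    change e * situationMean d (fun h => 1 - playerMix p h) (if b then 1 else 0)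
      [y.2.val, y.1.val] 0 (pairTotal y) =
      ((e * moveSum b d [y.2.val, y.1.val] 4 0 (pairTotal y) standHands +
        r * moveSum b d [y.2.val, y.1.val] 4 0 (pairTotal y) randomHands : ℕ) : ℝ) -
      ((e * shiftSum d [y.2.val, y.1.val] 4 standHands +
        r * shiftSum d [y.2.val, y.1.val] 4 randomHands : ℕ) : ℝ)
    rw [h, Nat.cast_add, Nat.cast_add, Nat.cast_mul, Nat.cast_mul, Nat.cast_mul, Nat.cast_mul]
    have hr' : (r : ℝ) = e - e * p := by rw [hp, ← hr]; push_cast; ring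
    rw [hr']
    ring

theorem situationMean_perm {L L' : List ℕ} (h : L.Perm L') (d : ℝ) (a : Hand → ℝ) (b : ℝ)
    (k t : ℕ) : situationMean d a b L k t = situationMean d a b L' k t := by
  simp only [situationMean, left_perm h, left_perm (h.cons _),
    moveMean_perm ((h.cons _).cons _)]

theorem pairTotal_swap (y : Hand) : pairTotal y.swap = pairTotal y := by
  simp [pairTotal, add_comm]

theorem situationPayoff_swap (d p b : ℝ) (y : Hand) (k : Option CardValue) :
    situationPayoff d p b y.swap k = situationPayoff d p b y k := by
  cases k with
  | some k =>
    simp only [situationPayoff, pairTotal_swap, Prod.fst_swap, Prod.snd_swap]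
    exact situationMean_perm ((List.Perm.swap _ _ _).cons _) ..
  | none =>
    simp only [situationPayoff, pairTotal_swap, Prod.fst_swap, Prod.snd_swap]
    exact situationMean_perm (List.Perm.swap _ _ _) ..

/-- Affinity in the drawing probability reduces each situation to the comparison of drawing with
standing. -/
theorem moveMean_affine (b d : ℝ) (L : List ℕ) (T t : ℕ) :
    moveMean b d L T t = moveMean 0 d L T t + b * (moveMean 1 d L T t - moveMean 0 d L T t) := by
  simp only [moveMean]; ring

theorem situationMean_affine (d : ℝ) (a : Hand → ℝ) (b : ℝ) (L : List ℕ) (k t : ℕ) :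
    situationMean d a b L k t = situationMean d a 0 L k t +
      b * (situationMean d a 1 L k t - situationMean d a 0 L k t) := by
  simp only [situationMean]
  rw [← Finset.sum_sub_distrib, Finset.mul_sum, ← Finset.sum_add_distrib]
  refine Finset.sum_congr rfl fun x _ => ?_
  split_ifs
  · ring
  · rw [moveMean_affine b]; ring

theorem situationPayoff_affine (d p b : ℝ) (y : Hand) (k : Option CardValue) :
    situationPayoff d p b y k = situationPayoff d p 0 y k +
      b * (situationPayoff d p 1 y k - situationPayoff d p 0 y k) := by
  cases k with
  | some k => exact situationMean_affine ..
  | none => exact situationMean_affine d (fun h => 1 - playerMix p h) b ..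

theorem scaledPayoff_playerMix (d p : ℝ) (b : Hand → Option CardValue → ℝ) :
    scaledPayoff d (playerMix p) b = ∑ y : Hand, if 8 ≤ pairTotal y then 0 else
      (∑ k : CardValue, ways d [k.val, y.2.val, y.1.val] *
        situationPayoff d p (b (handOf y) (some k)) y (some k)) +
      (52 * d - 5) * ways d [y.2.val, y.1.val] *
        situationPayoff d p (b (handOf y) none) y none :=
  scaledPayoff_eq_sum_banker d (playerMix p) b

/-- Changing Banker's moves changes the payoff in a direction determined situation by
situation. -/
theorem scaledPayoff_mono_banker {d : ℕ} (hd : 1 ≤ d) (p : ℝ)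
    {b c : Hand → Option CardValue → ℝ}
    (h : ∀ y k, ¬ 8 ≤ pairTotal y → 0 ≤ (c (handOf y) k - b (handOf y) k) *
      (situationPayoff d p 1 y k - situationPayoff d p 0 y k)) :
    scaledPayoff d (playerMix p) b ≤ scaledPayoff d (playerMix p) c := by
  have hd' : (1 : ℝ) ≤ d := by exact_mod_cast hd
  have key : ∀ y k, ¬ 8 ≤ pairTotal y → situationPayoff d p (b (handOf y) k) y k ≤
      situationPayoff d p (c (handOf y) k) y k := by
    intro y k hy
    rw [situationPayoff_affine d p (b _ _), situationPayoff_affine d p (c _ _)]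
    linarith [h y k hy]
  rw [scaledPayoff_playerMix, scaledPayoff_playerMix]
  refine Finset.sum_le_sum fun y _ => ?_
  split_ifs with hy
  · rfl
  · refine add_le_add (Finset.sum_le_sum fun k _ => ?_) ?_
    · exact mul_le_mul_of_nonneg_left (key y _ hy) (ways_nonneg hd (by simp))
    · exact mul_le_mul_of_nonneg_left (key y _ hy)
        (mul_nonneg (by linarith) (ways_nonneg hd (by simp)))


/-! ### Banker's table -/

/-- Banker's move in the table with index `N`, for cards given as numbers. -/
def tableMove (N : ℕ) (i j : ℕ) (k : Option ℕ) : Bool :=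
  bankerTable N (natHand i j) (k.map toCard)

/-- Whether Banker randomizes. -/
def isMixed (N : ℕ) (i j : ℕ) : Option ℕ → Bool
  | some _ => false
  | none => decide (natHand i j = mixedHand N)

/-- Banker's probability of drawing when he draws on `mixedHand N` with probability `q`. -/
noncomputable def bankerMix (N : ℕ) (q : ℝ) (h : Hand) (k : Option CardValue) : ℝ :=
  (1 - q) * bankerProb (bankerStands N) h k + q * bankerProb (bankerDraws N) h k

theorem map_toCard_val (k : Option CardValue) : (k.map Fin.val).map toCard = k := by
  cases k <;> simp [toCard_val]

theorem tableMove_val (N : ℕ) (y : Hand) (k : Option CardValue) :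
    tableMove N y.1.val y.2.val (k.map Fin.val) = bankerTable N (handOf y) k := by
  rw [tableMove, natHand_val, map_toCard_val]

theorem mem_bankerSituations {y : Hand} (hy : ¬ 8 ≤ pairTotal y) (k : Option CardValue) :
    (handOf y, k) ∈ bankerSituations := by
  have h : ∀ y : Hand, ¬ 8 ≤ pairTotal y → handOf y ∈ hands ∧ handTotal (handOf y) ≤ 7 := by
    decide +kernel
  simp [bankerSituations, h y hy]

theorem bankerProb_stands (N : ℕ) {y : Hand} (hy : ¬ 8 ≤ pairTotal y) (k : Option CardValue) :
    bankerProb (bankerStands N) (handOf y) k =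
      if tableMove N y.1.val y.2.val (k.map Fin.val) then 1 else 0 := by
  rw [tableMove_val]
  simp [bankerProb, bankerStands, mem_bankerSituations hy k]

/-- Since the table stands here, the drawing probability on this entry is exactly `q`, and the
indicators of the table and of the randomization never overlap. -/
theorem bankerTable_mixedHand (N : ℕ) : bankerTable N (mixedHand N) none = false := by
  by_cases h : N = 1
  · subst h; decide
  · simp only [mixedHand, h, if_false]
    simp [bankerTable, handTotal, total]

theorem bankerMix_eq (N : ℕ) (q : ℝ) {y : Hand} (hy : ¬ 8 ≤ pairTotal y) (k : Option CardValue) :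
    bankerMix N q (handOf y) k =
      (if tableMove N y.1.val y.2.val (k.map Fin.val) then 1 else 0) +
      (if isMixed N y.1.val y.2.val (k.map Fin.val) then q else 0) := by
  rw [bankerMix, bankerProb_stands N hy]
  have hm : isMixed N y.1.val y.2.val (k.map Fin.val) = decide ((handOf y, k) = (mixedHand N, none)) := by
    cases k <;> simp [isMixed, natHand_val]
  have hd : bankerProb (bankerDraws N) (handOf y) k =
      if tableMove N y.1.val y.2.val (k.map Fin.val) = true ∨ (handOf y, k) = (mixedHand N, none)
        then 1 else 0 := by
    rw [tableMove_val]
    simp only [bankerProb, bankerDraws, Finset.mem_filter, mem_bankerSituations hy k, true_and]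
  rw [hd, hm]
  by_cases h : (handOf y, k) = (mixedHand N, none)
  · have h1 : tableMove N y.1.val y.2.val (k.map Fin.val) = false := by
      rw [tableMove_val]
      simp only [Prod.mk.injEq] at h
      rw [h.1, h.2, bankerTable_mixedHand]
    rw [h1]; simp [h]
  · simp only [h, or_false, decide_false, Bool.false_eq_true, if_false]
    split_ifs <;> simp

/-- The optimality condition for Banker's table. -/
def BankerOptimal (N : ℕ) (d p : ℝ) : Prop :=
  ∀ (y : Hand) (k : Option CardValue), ¬ 8 ≤ pairTotal y →
    if isMixed N y.1.val y.2.val (k.map Fin.val) then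
      situationPayoff d p 1 y k = situationPayoff d p 0 y k
    else if tableMove N y.1.val y.2.val (k.map Fin.val) then
      situationPayoff d p 1 y k ≤ situationPayoff d p 0 y k
    else situationPayoff d p 0 y k ≤ situationPayoff d p 1 y k

theorem bankerProb_nonneg_le_one (T : BankerPure) (h : Hand) (k : Option CardValue) :
    0 ≤ bankerProb T h k ∧ bankerProb T h k ≤ 1 := by
  unfold bankerProb; split_ifs <;> simp

/-- Where the table draws, drawing is at most as good for Player as standing, and a deviation can
only lower the drawing probability. Where it stands, both relations are reversed. On the randomizing
situation the two payoffs agree. -/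
theorem BankerOptimal.le_scaledPayoff {N d : ℕ} {p : ℝ} (h : BankerOptimal N d p) (hd : 1 ≤ d)
    (T : BankerPure) :
    scaledPayoff d (playerMix p) (bankerProb (bankerStands N)) ≤
      scaledPayoff d (playerMix p) (bankerProb T) := by
  refine scaledPayoff_mono_banker hd p fun y k hy => ?_
  have hT := bankerProb_nonneg_le_one T (handOf y) k
  have := h y k hy
  rw [bankerProb_stands N hy]
  split_ifs at this ⊢ <;> nlinarith

/-- The two strategies differ only where Banker is indifferent, so each inequality of
`scaledPayoff_mono_banker` holds with both sides interchanged. -/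
theorem BankerOptimal.scaledPayoff_bankerMix {N d : ℕ} {p : ℝ} (h : BankerOptimal N d p)
    (hd : 1 ≤ d) (q : ℝ) :
    scaledPayoff d (playerMix p) (bankerMix N q) =
      scaledPayoff d (playerMix p) (bankerProb (bankerStands N)) := by
  refine le_antisymm (scaledPayoff_mono_banker hd p fun y k hy => ?_)
    (scaledPayoff_mono_banker hd p fun y k hy => ?_)
  all_goals
    have := h y k hy
    rw [bankerProb_stands N hy, bankerMix_eq N q hy]
    split_ifs at this ⊢ <;> simp_all

/-- The order of Banker's two cards is immaterial for the payoff and for the table. -/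
theorem bankerOptimal_of_hands {N : ℕ} {d p : ℝ}
    (h : ∀ (y : Hand) (k : Option CardValue), y.1 ≤ y.2 → ¬ 8 ≤ pairTotal y →
    if isMixed N y.1.val y.2.val (k.map Fin.val) then
      situationPayoff d p 1 y k = situationPayoff d p 0 y k
    else if tableMove N y.1.val y.2.val (k.map Fin.val) then
      situationPayoff d p 1 y k ≤ situationPayoff d p 0 y k
    else situationPayoff d p 0 y k ≤ situationPayoff d p 1 y k) : BankerOptimal N d p := by
  intro y k hy
  rcases le_total y.1 y.2 with hle | hle
  · exact h y k hle hy
  · have := h y.swap k hle (by rwa [pairTotal_swap])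
    have h1 : tableMove N y.2.val y.1.val (k.map Fin.val) =
        tableMove N y.1.val y.2.val (k.map Fin.val) := by
      rw [tableMove, tableMove, natHand_comm]
    have h2 : isMixed N y.2.val y.1.val (k.map Fin.val) =
        isMixed N y.1.val y.2.val (k.map Fin.val) := by
      cases k <;> simp [isMixed, natHand_comm]
    simpa only [situationPayoff_swap, Prod.fst_swap, Prod.snd_swap, h1, h2] using this

/-! ### The value -/

/-- The sum over all cards. -/
def cardSum (f : ℕ → ℕ) : List ℕ → ℕ
  | [] => 0
  | a :: l => Nat.add (f a) (cardSum f l)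

/-- All cards. -/
def cards : List ℕ := [0, 1, 2, 3, 4, 5, 6, 7, 8, 9]

theorem cardSum_eq (f : ℕ → ℕ) : (cardSum f cards : ℝ) = ∑ k : CardValue, (f k.val : ℝ) := by
  simp [cardSum, cards, Fin.sum_univ_succ]

/-- The sum of `f` over the situations of Banker, weighted by the numbers of ways in which they
arise. -/
def situationSum (d : ℕ) (f : ℕ → ℕ → Option ℕ → ℕ) : ℕ :=
  handSum d [] (fun _ i j => Nat.add
    (cardSum (fun k => Nat.mul (cardsLeft d [j, i] k) (f i j (some k))) cards)
    (Nat.mul (Nat.sub (Nat.mul 52 d) 5) (f i j none))) playHands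

/-- Passage from a real sum over ordered pairs of cards to natural sums over hands: `f` carries the
shifted scores and `f'` the shift. -/
theorem situationSum_eq {d : ℕ} (hd : 1 ≤ d) (f f' : ℕ → ℕ → Option ℕ → ℕ)
    (g : ℕ → ℕ → Option ℕ → ℝ) (hg : ∀ h ∈ playHands, ∀ k : Option CardValue,
      g h.2.1 h.2.2 (k.map Fin.val) = f h.2.1 h.2.2 (k.map Fin.val) -
        f' h.2.1 h.2.2 (k.map Fin.val))
    (hgs : ∀ i j k, g i j k = g j i k) :
    (∑ y : Hand, if 8 ≤ pairTotal y then 0 else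
      (∑ k : CardValue, ways d [k.val, y.2.val, y.1.val] * g y.1.val y.2.val (some k.val)) +
      (52 * d - 5) * ways d [y.2.val, y.1.val] * g y.1.val y.2.val none) =
    situationSum d f - situationSum d f' := by
  rw [sum_playHands (fun i j => (∑ k : CardValue, ways d [k.val, j, i] * g i j (some k.val)) +
      (52 * d - 5) * ways d [j, i] * g i j none), situationSum, situationSum,
    handSum_eq hd (by simp), handSum_eq hd (by simp), sum_map_sub]
  · refine congrArg List.sum (List.map_congr_left fun h hh => ?_)
    rw [← mul_sub]
    congr 1
    have h1 := hg h hh none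
    have h2 := fun k => hg h hh (some k)
    simp only [Option.map_some, Option.map_none] at h1 h2
    have h5 : 5 ≤ 52 * d := by omega
    simp only [Nat.add_eq, Nat.mul_eq, Nat.sub_eq, Nat.cast_add, Nat.cast_mul, cardSum_eq, h1, h2,
      Nat.cast_sub h5, ways, cardsLeft_eq hd (show [h.2.2, h.2.1].length ≤ 4 by simp)]
    rw [← mul_sub, add_sub_add_comm, ← Finset.sum_sub_distrib, mul_add, Finset.mul_sum]
    congr 1
    · exact Finset.sum_congr rfl fun k _ => by ring
    · push_cast; ring
  · intro i j
    have h1 : ∀ k : CardValue, ways (d : ℝ) [k.val, i, j] = ways d [k.val, j, i] := fun k =>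
      ways_perm ((List.Perm.swap _ _ _).cons _)
    have h2 : ways (d : ℝ) [i, j] = ways d [j, i] := ways_perm (List.Perm.swap _ _ _)
    simp only [h1, h2, hgs i j]

/-- The scaled value in natural numbers. -/
def valueScore (N d m e r : ℕ) : ℕ :=
  situationSum d fun i j k => situationScore d m e r (tableMove N i j k) i j k

/-- The part of `valueScore` that is due to the shift. -/
def valueShift (d m e r : ℕ) : ℕ := situationSum d (situationShift d m e r)

/-- The strategy `bankerStands` is enough for the value: by `BankerOptimal.scaledPayoff_bankerMix`
the payoff is the same for every `q`. -/
theorem value_eq (N : ℕ) {d m e r : ℕ} (hd : 1 ≤ d) (hr : m + r = e) {p : ℝ} (hp : e * p = m) :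
    e * scaledPayoff d (playerMix p) (bankerProb (bankerStands N)) =
      valueScore N d m e r - valueShift d m e r := by
  rw [valueScore, valueShift, ← situationSum_eq hd _ _ (fun i j k => e * situationPayoff d p
    (if tableMove N i j k then 1 else 0) (toCard i, toCard j) (k.map toCard)),
    scaledPayoff_playerMix, Finset.mul_sum]
  · refine Finset.sum_congr rfl fun y _ => ?_
    by_cases hy : 8 ≤ pairTotal y
    · simp [hy]
    · simp only [hy, if_false, mul_add, Finset.mul_sum, toCard_val, Option.map_some,
        Option.map_none, bankerProb_stands N hy]
      congr 1
      · exact Finset.sum_congr rfl fun k _ => by ring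
      · ring
  · intro h hh k
    obtain ⟨h1, h2, -, -⟩ := mem_playHands h hh
    have := situationPayoff_eq hd hr hp (tableMove N h.2.1 h.2.2 (k.map Fin.val))
      (toCard h.2.1, toCard h.2.2) k
    simpa only [val_toCard h1, val_toCard h2, map_toCard_val] using this
  · intro i j k
    have h1 : tableMove N i j k = tableMove N j i k := by
      rw [tableMove, tableMove, natHand_comm]
    rw [h1, ← situationPayoff_swap, Prod.swap_prod_mk]


/-! ### Player's decisions -/

/-- The shifted score when Player draws on the hand `(x₁, x₂)` and Banker follows the table. -/
def rowDraw (N d x₁ x₂ : ℕ) : ℕ :=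
  handSum d [x₂, x₁] (fun t i j => cardSum (fun k => Nat.mul (cardsLeft d [j, i, x₂, x₁] k)
    (moveScore (tableMove N i j (some k)) d 5 (Nat.mod (Nat.add (Nat.mod (Nat.add x₁ x₂) 10) k) 10)
      t [k, j, i, x₂, x₁])) cards) playHands

/-- The shifted score when Player stands on the hand `(x₁, x₂)` and Banker follows the table. -/
def rowStand (N d x₁ x₂ : ℕ) : ℕ :=
  Nat.mul (Nat.sub (Nat.mul 52 d) 5) (handSum d [x₂, x₁] (fun t i j =>
    moveScore (tableMove N i j none) d 4 (Nat.mod (Nat.add x₁ x₂) 10) t [j, i, x₂, x₁]) playHands)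

/-- The hand on which Banker randomizes. -/
def mixedHands (N : ℕ) : List (ℕ × ℕ × ℕ) := bif Nat.beq N 1 then [(6, 8, 8)] else [(6, 0, 6)]

/-- The part of the shifted score that belongs to the hand on which Banker randomizes. -/
def rowMixed (N : ℕ) (b : Bool) (d x₁ x₂ : ℕ) : ℕ :=
  Nat.mul (Nat.sub (Nat.mul 52 d) 5) (handSum d [x₂, x₁] (fun t i j =>
    moveScore b d 4 (Nat.mod (Nat.add x₁ x₂) 10) t [j, i, x₂, x₁]) (mixedHands N))

/-- Player's gain from drawing. -/
noncomputable def drawGain (d : ℝ) (b : Hand → Option CardValue → ℝ) (x : Hand) : ℝ :=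
  drawMean d b x - standMean d b x

theorem mem_playHands_total {h : ℕ × ℕ × ℕ} (hh : h ∈ playHands) (h1 : h.2.1 < 10)
    (h2 : h.2.2 < 10) : pairTotal (toCard h.2.1, toCard h.2.2) = h.1 ∧
      ¬ 8 ≤ pairTotal (toCard h.2.1, toCard h.2.2) := by
  obtain ⟨-, -, h3, h4⟩ := mem_playHands h hh
  have e : pairTotal (toCard h.2.1, toCard h.2.2) = h.1 := by
    simp only [pairTotal, val_toCard h1, val_toCard h2, h3]
  exact ⟨e, by rw [e]; omega⟩

theorem mixedHands_spec (N : ℕ) (F : ℕ × ℕ × ℕ → ℝ) :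
    (playHands.map fun h => if isMixed N h.2.1 h.2.2 none then F h else 0).sum =
      ((mixedHands N).map F).sum := by
  have h1 : playHands.map (fun h => decide (natHand h.2.1 h.2.2 = (8, 8))) =
    playHands.map (fun h => decide (h = (6, 8, 8))) := by decide +kernel
  have h2 : playHands.map (fun h => decide (natHand h.2.1 h.2.2 = (0, 6))) =
    playHands.map (fun h => decide (h = (6, 0, 6))) := by decide +kernel
  rw [List.map_inj_left] at h1 h2
  by_cases h : N = 1
  · subst h
    have : ∀ h ∈ playHands, (if isMixed 1 h.2.1 h.2.2 none then F h else 0) =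
        if h = (6, 8, 8) then F h else 0 := by
      intro h hh
      simp only [isMixed, mixedHand, if_true, h1 h hh, decide_eq_true_eq]
    rw [List.map_congr_left this]
    simp [mixedHands, playHands, drawHands, randomHands, standHands]
  · have hN : Nat.beq N 1 = false := Bool.eq_false_iff.2 fun e => h (Nat.eq_of_beq_eq_true e)
    have : ∀ h ∈ playHands, (if isMixed N h.2.1 h.2.2 none then F h else 0) =
        if h = (6, 0, 6) then F h else 0 := by
      intro h' hh
      simp only [isMixed, mixedHand, h, if_false, h2 h' hh, decide_eq_true_eq]
    rw [List.map_congr_left this]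
    simp [mixedHands, hN, playHands, drawHands, randomHands, standHands]

/-- The number of ways in which Banker's first two cards form a hand that is not a natural. -/
noncomputable def playWays (d : ℝ) (L : List ℕ) : ℝ :=
  (playHands.map fun h => orders h.2.1 h.2.2 *
    (left d L h.2.1 * left d (h.2.1 :: L) h.2.2)).sum

theorem bankerMix_natHand (N : ℕ) (q : ℝ) {h : ℕ × ℕ × ℕ} (hh : h ∈ playHands)
    (k : Option CardValue) : bankerMix N q (natHand h.2.1 h.2.2) k =
      (if tableMove N h.2.1 h.2.2 (k.map Fin.val) then 1 else 0) +
      (if isMixed N h.2.1 h.2.2 (k.map Fin.val) then q else 0) := by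
  obtain ⟨h1, h2, -, -⟩ := mem_playHands h hh
  have := bankerMix_eq N q (y := (toCard h.2.1, toCard h.2.2)) (mem_playHands_total hh h1 h2).2 k
  rw [← natHand_val] at this
  simpa only [val_toCard h1, val_toCard h2] using this

/-- No `q` occurs, because Banker randomizes only when Player stands. The subtracted term is the
shift over all continuations by two cards; it recurs in `standMean_eq` and cancels in `drawGain`. -/
theorem drawMean_eq (N : ℕ) (q : ℝ) {d : ℕ} (hd : 1 ≤ d) (x : Hand) :
    drawMean d (bankerMix N q) x = rowDraw N d x.1.val x.2.val -
      2 * (52 * d - 5) * (52 * d - 4) * playWays d [x.2.val, x.1.val] := by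
  have hs := sum_playHands (fun i j => (left d [x.2.val, x.1.val] i *
      left d (i :: [x.2.val, x.1.val]) j) *
      ∑ k : CardValue, left d [j, i, x.2.val, x.1.val] k.val *
        moveMean (bankerMix N q (natHand i j) (some k)) d [k.val, j, i, x.2.val, x.1.val]
          ((pairTotal x + k.val) % 10) ((i + j) % 10)) (fun i j => by
    rw [left_mul_left_comm, natHand_comm, add_comm i j]
    congr 1
    refine Finset.sum_congr rfl fun k _ => ?_
    rw [left_perm (List.Perm.swap _ _ _), moveMean_perm ((List.Perm.swap _ _ _).cons _)])
  simp only [natHand_val] at hs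
  rw [drawMean]
  refine hs.trans ?_
  rw [rowDraw, handSum_eq hd (by simp), playWays, ← List.sum_map_mul_left, sum_map_sub]
  refine congrArg List.sum (List.map_congr_left fun h hh => ?_)
  obtain ⟨h1, h2, h3, -⟩ := mem_playHands h hh
  -- The factor is turned into a sum over Player's third card, over which the shift is distributed.
  have e4 : (52 * d - 4 : ℝ) =
      ∑ k : CardValue, left d [h.2.2, h.2.1, x.2.val, x.1.val] k.val := by
    rw [← sum_left_four d (toCard h.2.2) (toCard h.2.1) x.2 x.1, val_toCard h1, val_toCard h2]
  have key : ∀ k : CardValue,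
      moveMean (bankerMix N q (natHand h.2.1 h.2.2) (some k)) d
        [k.val, h.2.2, h.2.1, x.2.val, x.1.val] ((pairTotal x + k.val) % 10)
        ((h.2.1 + h.2.2) % 10) =
      moveScore (tableMove N h.2.1 h.2.2 (some k.val)) d 5 ((pairTotal x + k.val) % 10) h.1
        [k.val, h.2.2, h.2.1, x.2.val, x.1.val] - 2 * (52 * d - 5) := by
    intro k
    have := moveMean_eq hd [k, toCard h.2.2, toCard h.2.1, x.2, x.1] (n := 5) rfl le_rfl
      (Nat.mod_lt (pairTotal x + k.val) (by norm_num : 10 > 0))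
      (Nat.mod_lt (h.2.1 + h.2.2) (by norm_num : 10 > 0))
      (tableMove N h.2.1 h.2.2 (some k.val))
    simp only [List.map_cons, List.map_nil, val_toCard h1, val_toCard h2] at this
    rw [bankerMix_natHand N q hh]
    simp only [Option.map_some, isMixed, Bool.false_eq_true, if_false, add_zero]
    rw [this, h3]
    norm_num
  simp only [key, cardSum_eq, Nat.mul_eq, Nat.cast_mul,
    cardsLeft_eq hd (show [h.2.2, h.2.1, x.2.val, x.1.val].length ≤ 4 by simp)]
  rw [e4]
  have hT : ∀ k, Nat.mod (Nat.add (Nat.mod (Nat.add x.1.val x.2.val) 10) k) 10 =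
      (pairTotal x + k) % 10 := fun _ => rfl
  simp only [hT, mul_sub _ _ (2 * (52 * (d : ℝ) - 5)), Finset.sum_sub_distrib, ← Finset.sum_mul]
  ring

theorem standMean_eq (N : ℕ) (q : ℝ) {d : ℕ} (hd : 1 ≤ d) (x : Hand) :
    standMean d (bankerMix N q) x = rowStand N d x.1.val x.2.val +
      q * (rowMixed N true d x.1.val x.2.val - rowMixed N false d x.1.val x.2.val) -
      2 * (52 * d - 5) * (52 * d - 4) * playWays d [x.2.val, x.1.val] := by
  have hs := sum_playHands (fun i j => (left d [x.2.val, x.1.val] i *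
      left d (i :: [x.2.val, x.1.val]) j) *
        moveMean (bankerMix N q (natHand i j) none) d [j, i, x.2.val, x.1.val]
          (pairTotal x) ((i + j) % 10)) (fun i j => by
    rw [left_mul_left_comm, natHand_comm, add_comm i j, moveMean_perm (List.Perm.swap _ _ _)])
  simp only [natHand_val] at hs
  have hs' : standMean d (bankerMix N q) x = _ := congrArg (fun z => (52 * (d : ℝ) - 5) * z) hs
  have h5 : 5 ≤ 52 * d := by omega
  have c5 : ((Nat.sub (Nat.mul 52 d) 5 : ℕ) : ℝ) = 52 * d - 5 := by
    rw [Nat.sub_eq, Nat.mul_eq, Nat.cast_sub h5]; push_cast; ring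
  have hm : ∀ b : Bool, (rowMixed N b d x.1.val x.2.val : ℝ) = (52 * d - 5) *
      (playHands.map fun h => if isMixed N h.2.1 h.2.2 none then orders h.2.1 h.2.2 *
      (left d [x.2.val, x.1.val] h.2.1 * left d (h.2.1 :: [x.2.val, x.1.val]) h.2.2 *
        moveScore b d 4 (pairTotal x) h.1 [h.2.2, h.2.1, x.2.val, x.1.val]) else 0).sum := by
    intro b
    rw [mixedHands_spec, rowMixed, Nat.mul_eq, Nat.cast_mul, handSum_eq hd (by simp), c5]
    rfl
  rw [hs', hm, hm, rowStand, Nat.mul_eq, Nat.cast_mul, handSum_eq hd (by simp), c5, playWays]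
  have hr : ∀ A B C D E : ℝ, A = B + q * (C - D) - 2 * (52 * d - 4) * E →
      (52 * d - 5) * A = (52 * d - 5) * B + q * ((52 * d - 5) * C - (52 * d - 5) * D) -
        2 * (52 * d - 5) * (52 * d - 4) * E := by
    rintro A B C D E rfl; ring
  refine hr _ _ _ _ _ ?_
  rw [sum_map_sub, ← List.sum_map_mul_left, ← List.sum_map_add, ← List.sum_map_mul_left,
    sum_map_sub]
  refine congrArg List.sum (List.map_congr_left fun h hh => ?_)
  obtain ⟨h1, h2, h3, -⟩ := mem_playHands h hh
  have key : ∀ b : Bool, moveMean (if b then 1 else 0) d [h.2.2, h.2.1, x.2.val, x.1.val]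
        (pairTotal x) h.1 = moveScore b d 4 (pairTotal x) h.1
        [h.2.2, h.2.1, x.2.val, x.1.val] - 2 * (52 * d - 4) := by
    intro b
    have := moveMean_eq hd [toCard h.2.2, toCard h.2.1, x.2, x.1] (n := 4) rfl (by norm_num)
      (pairTotal_lt x) (Nat.mod_lt (h.2.1 + h.2.2) (by norm_num : 10 > 0)) b
    simp only [List.map_cons, List.map_nil, val_toCard h1, val_toCard h2, h3] at this
    rw [this]
    norm_num
  have k1 := key true
  have k0 := key false
  simp only [if_true, Bool.false_eq_true, if_false] at k1 k0
  rw [bankerMix_natHand N q hh]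
  simp only [Option.map_none]
  have hT : (x.1.val.add x.2.val).mod 10 = pairTotal x := rfl
  rw [h3, hT]
  -- On the randomizing hand the extra probability `q` adds `q` times the difference between drawing
  -- and standing, by affinity.
  by_cases hmix : isMixed N h.2.1 h.2.2 none
  · simp only [hmix, if_true]
    have := key (tableMove N h.2.1 h.2.2 none)
    rw [moveMean_affine] at this ⊢
    rw [k1, k0] at this ⊢
    linear_combination (orders h.2.1 h.2.2 *
      (left d [x.2.val, x.1.val] h.2.1 * left d [h.2.1, x.2.val, x.1.val] h.2.2)) * this
  · simp only [hmix, if_false, add_zero, Bool.false_eq_true]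
    rw [key]
    ring

theorem drawGain_eq (N : ℕ) (q : ℝ) {d : ℕ} (hd : 1 ≤ d) (x : Hand) :
    drawGain d (bankerMix N q) x = rowDraw N d x.1.val x.2.val - rowStand N d x.1.val x.2.val -
      q * (rowMixed N true d x.1.val x.2.val - rowMixed N false d x.1.val x.2.val) := by
  rw [drawGain, drawMean_eq N q hd, standMean_eq N q hd]; ring

theorem drawGain_swap (d : ℝ) (b : Hand → Option CardValue → ℝ) (x : Hand) :
    drawGain d b x.swap = drawGain d b x := by
  have h2 : [x.1.val, x.2.val].Perm [x.2.val, x.1.val] := List.Perm.swap _ _ _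
  simp only [drawGain, drawMean, standMean, pairTotal_swap, Prod.fst_swap, Prod.snd_swap,
    left_perm h2, left_perm (h2.cons _), left_perm ((h2.cons _).cons _),
    moveMean_perm ((h2.cons _).cons _), moveMean_perm (((h2.cons _).cons _).cons _)]

/-- The hands on which Player may choose and draws. -/
def choiceDrawHands : List (ℕ × ℕ) := [(0, 5), (6, 9), (7, 8)]

/-- The optimality condition for Player's strategy. -/
structure PlayerOptimal (N : ℕ) (d q : ℝ) : Prop where
  draw : ∀ h ∈ choiceDrawHands, 0 ≤ drawGain d (bankerMix N q) (toCard h.1, toCard h.2)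
  random : drawGain d (bankerMix N q) (toCard 1, toCard 4) = 0
  stand : drawGain d (bankerMix N q) (toCard 2, toCard 3) ≤ 0

theorem playerProb_nonneg_le_one (S : PlayerPure) (h : Hand) :
    0 ≤ playerProb S h ∧ playerProb S h ≤ 1 := by
  unfold playerProb; split_ifs <;> simp

/-- The payoff separates over Player's hands. On hands with another total `S` is forced to agree
with the mixture, by `mustDraw ⊆ S ⊆ mayDraw`; on the hands with total 5 the sign of `drawGain`
decides. The value of `p` is immaterial since drawing on `(1,4)` gains nothing. -/
theorem PlayerOptimal.scaledPayoff_le {N d : ℕ} {q : ℝ} (h : PlayerOptimal N d q) (hd : 1 ≤ d)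
    (p : ℝ) (S : PlayerPure) :
    scaledPayoff d (playerProb S) (bankerMix N q) ≤
      scaledPayoff d (playerMix p) (bankerMix N q) := by
  have hx : ∀ x : Hand, ¬ 8 ≤ pairTotal x → ∃ h ∈ playHands, handOf x = natHand h.2.1 h.2.2 ∧
      (x = (toCard h.2.1, toCard h.2.2) ∨ x = Prod.swap (toCard h.2.1, toCard h.2.2)) := by
    decide +kernel
  have hdraw : ∀ h ∈ drawHands, natHand h.2.1 h.2.2 ∈ mustDraw ∨ h.2 ∈ choiceDrawHands := by
    decide +kernel
  have hstand : ∀ h ∈ standHands, natHand h.2.1 h.2.2 ∉ mayDraw ∨ h.2 = (2, 3) := by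
    decide +kernel
  have key : ∀ x, ¬ 8 ≤ pairTotal x → 0 ≤ (playerMix p (handOf x) - playerProb S (handOf x)) *
      drawGain d (bankerMix N q) x := by
    intro x hx8
    obtain ⟨⟨t, i, j⟩, hh, he, hsw⟩ := hx x hx8
    have hg : drawGain d (bankerMix N q) x =
        drawGain d (bankerMix N q) (toCard i, toCard j) := by
      rcases hsw with rfl | rfl
      · rfl
      · exact drawGain_swap ..
    rw [hg, he]
    have hS := playerProb_nonneg_le_one S (natHand i j)
    simp only [playHands, List.mem_append] at hh
    rcases hh with hh | hh | hh
    · have hp := playerMix_draw p _ hh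
      simp only at hp ⊢
      rw [hp]
      rcases hdraw _ hh with hm | hm
      · have : playerProb S (natHand i j) = 1 := by
          rw [playerProb, if_pos (Finset.mem_of_subset S.2.1 hm)]
        simp [this]
      · have hd := h.draw (i, j) hm
        dsimp only at hd
        have hS' : 0 ≤ 1 - playerProb S (natHand i j) := by linarith
        exact mul_nonneg hS' hd
    · simp only [randomHands, List.mem_singleton, Prod.mk.injEq] at hh
      obtain ⟨-, rfl, rfl⟩ := hh
      rw [h.random, mul_zero]
    · have hp := playerMix_stand p _ hh
      simp only at hp ⊢
      rw [hp]
      rcases hstand _ hh with hm | hm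
      · have : playerProb S (natHand i j) = 0 := by
          rw [playerProb, if_neg fun hmem => hm (Finset.mem_of_subset S.2.2 hmem)]
        simp [this]
      · simp only [Prod.mk.injEq] at hm
        obtain ⟨rfl, rfl⟩ := hm
        have hS' : 0 - playerProb S (natHand 2 3) ≤ 0 := by linarith
        exact mul_nonneg_of_nonpos_of_nonpos hS' h.stand
  rw [scaledPayoff_eq_sum_player, scaledPayoff_eq_sum_player]
  refine Finset.sum_le_sum fun x _ => ?_
  split_ifs with hx8
  · rfl
  · refine mul_le_mul_of_nonneg_left ?_ (ways_nonneg hd (by simp))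
    have := key x hx8
    rw [drawGain] at this
    linarith


/-! ### Comparison of polynomials with natural coefficients -/

/-- `f` is a polynomial function with natural coefficients. -/
def NatPoly (f : ℕ → ℕ) : Prop := ∃ P : Polynomial ℕ, ∀ t, f t = P.eval t

namespace NatPoly

variable {f g : ℕ → ℕ}

theorem const (c : ℕ) : NatPoly fun _ => c := ⟨Polynomial.C c, fun t => by simp⟩

theorem add (hf : NatPoly f) (hg : NatPoly g) : NatPoly fun t => Nat.add (f t) (g t) := by
  obtain ⟨P, hP⟩ := hf
  obtain ⟨Q, hQ⟩ := hg
  exact ⟨P + Q, fun t => by simp [hP, hQ]⟩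

theorem mul (hf : NatPoly f) (hg : NatPoly g) : NatPoly fun t => Nat.mul (f t) (g t) := by
  obtain ⟨P, hP⟩ := hf
  obtain ⟨Q, hQ⟩ := hg
  exact ⟨P * Q, fun t => by simp [hP, hQ]⟩

theorem shift (s : ℕ) : NatPoly fun t => Nat.add t s :=
  ⟨Polynomial.X + Polynomial.C s, fun t => by simp⟩

/-- The hypothesis rules out truncation for every `t`, and the constant term `c * s - n` is then a
natural number. This is the reason for the substitution `d = t + s`. -/
theorem linear {c n s : ℕ} (h : n ≤ c * s) :
    NatPoly fun t => Nat.sub (Nat.mul c (Nat.add t s)) n := by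
  refine ⟨Polynomial.C c * Polynomial.X + Polynomial.C (c * s - n), fun t => ?_⟩
  simp only [Nat.sub_eq, Nat.mul_eq, Nat.add_eq, Polynomial.eval_add, Polynomial.eval_mul,
    Polynomial.eval_C, Polynomial.eval_X, mul_add]
  omega

end NatPoly

/-- Comparison of the first `n` digits to base `B`; the other digits of `m` vanish. -/
def digitsLe (B : ℕ) : ℕ → ℕ → ℕ → Bool
  | 0, m, _ => Nat.beq m 0
  | n + 1, m, k => Nat.ble (Nat.mod m B) (Nat.mod k B) && digitsLe B n (Nat.div m B) (Nat.div k B)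

theorem eval_eq_coeff_add (P : Polynomial ℕ) (t : ℕ) :
    P.eval t = P.coeff 0 + t * P.divX.eval t := by
  conv_lhs => rw [← P.divX_mul_X_add]
  simp [mul_comm, add_comm]

/-- When all coefficients are below `B`, they are the base-`B` digits of the value at `B`. Comparing
digits thus compares coefficients, which suffices for an inequality at every natural number. After
`n` digits the rest of `P` must vanish, whereas `Q` may have further terms. -/
theorem eval_le_of_digitsLe {B n : ℕ} (hB : 0 < B) {P Q : Polynomial ℕ}
    (hP : ∀ i, P.coeff i < B) (hQ : ∀ i, Q.coeff i < B)
    (h : digitsLe B n (P.eval B) (Q.eval B) = true) (t : ℕ) : P.eval t ≤ Q.eval t := by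
  induction n generalizing P Q with
  | zero =>
    have h0 : P.eval B = 0 := Nat.eq_of_beq_eq_true h
    have : P = 0 := by
      ext i
      rw [Polynomial.eval_eq_sum, Polynomial.sum, Finset.sum_eq_zero_iff] at h0
      by_contra hi
      have := h0 i (Polynomial.mem_support_iff.2 hi)
      exact (Nat.mul_pos (Nat.pos_of_ne_zero hi) (Nat.pow_pos hB)).ne' this
    simp [this]
  | succ n ih =>
    have hmod : ∀ R : Polynomial ℕ, (∀ i, R.coeff i < B) →
        R.eval B % B = R.coeff 0 ∧ R.eval B / B = R.divX.eval B := by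
      intro R hR
      rw [eval_eq_coeff_add R B, Nat.add_mul_mod_self_left, Nat.mod_eq_of_lt (hR 0),
        Nat.add_mul_div_left _ _ hB, Nat.div_eq_of_lt (hR 0), zero_add]
      exact ⟨rfl, rfl⟩
    rw [digitsLe, Bool.and_eq_true] at h
    obtain ⟨h1, h2⟩ := h
    have h1' : P.eval B % B ≤ Q.eval B % B := Nat.le_of_ble_eq_true h1
    rw [(hmod P hP).1, (hmod Q hQ).1] at h1'
    have h2' : digitsLe B n (P.eval B / B) (Q.eval B / B) = true := h2
    rw [(hmod P hP).2, (hmod Q hQ).2] at h2'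
    have := ih (fun i => by rw [Polynomial.coeff_divX]; exact hP _)
      (fun i => by rw [Polynomial.coeff_divX]; exact hQ _) h2'
    rw [eval_eq_coeff_add P, eval_eq_coeff_add Q]
    exact add_le_add h1' (Nat.mul_le_mul_left t this)

/-- A test for `f ≤ g`, when `f` and `g` are polynomials with natural coefficients: their values at
`1` bound the coefficients, which are then the digits of the values at `B = 2 ^ 128`. -/
def polyLe (f g : ℕ → ℕ) : Bool :=
  Nat.blt (f 1) 340282366920938463463374607431768211456 &&
  (Nat.blt (g 1) 340282366920938463463374607431768211456 &&
  digitsLe 340282366920938463463374607431768211456 12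
    (f 340282366920938463463374607431768211456) (g 340282366920938463463374607431768211456))

theorem NatPoly.le_of_polyLe {f g : ℕ → ℕ} (hf : NatPoly f) (hg : NatPoly g)
    (h : polyLe f g = true) (t : ℕ) : f t ≤ g t := by
  obtain ⟨P, hP⟩ := hf
  obtain ⟨Q, hQ⟩ := hg
  simp only [polyLe, Bool.and_eq_true, hP, hQ, Nat.blt_eq] at h
  obtain ⟨h1, h2, h3⟩ := h
  -- The value at 1 is the sum of the natural coefficients, hence bounds each of them.
  have hc : ∀ (R : Polynomial ℕ) (B : ℕ), R.eval 1 < B → ∀ i, R.coeff i < B := by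
    intro R B hR i
    refine lt_of_le_of_lt ?_ hR
    by_cases hi : i ∈ R.support
    · rw [Polynomial.eval_eq_sum, Polynomial.sum]
      simpa using Finset.single_le_sum (f := fun i => R.coeff i) (fun _ _ => Nat.zero_le _) hi
    · rw [Polynomial.notMem_support_iff.1 hi]; exact Nat.zero_le _
  rw [hP, hQ]
  exact eval_le_of_digitsLe (by norm_num) (hc P _ h1) (hc Q _ h2) h3 t

/-! ### Polynomial dependence on the number of decks -/

/-- Two decks hold at least eight cards of each value, more than the at most five known cards; hence
nothing is truncated from `s = 2` on. -/
theorem natPoly_cardsLeft {s : ℕ} (hs : 2 ≤ s) {L : List ℕ} (hL : L.length ≤ 5) (v : ℕ) :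
    NatPoly fun t => cardsLeft (Nat.add t s) L v := by
  refine NatPoly.linear ?_
  have h1 := occ_le_length v L
  have h2 : 4 ≤ copies v := by unfold copies; cases Nat.beq v 0 <;> simp
  nlinarith

theorem natPoly_handWays {s : ℕ} (hs : 2 ≤ s) {L : List ℕ} (hL : L.length ≤ 5) (i j : ℕ) :
    NatPoly fun t => handWays (Nat.add t s) L i j := by
  unfold handWays
  cases Nat.beq i j
  · exact (NatPoly.const 2).mul ((natPoly_cardsLeft hs hL i).mul (natPoly_cardsLeft hs hL j))
  · refine (natPoly_cardsLeft hs hL i).mul ?_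
    have h1 := occ_le_length i L
    have h2 : 4 ≤ copies i := by unfold copies; cases Nat.beq i 0 <;> simp
    have : (fun t => Nat.sub (cardsLeft (Nat.add t s) L i) 1) =
        fun t => Nat.sub (Nat.mul (copies i) (Nat.add t s)) (occ i L + 1) := by
      funext t; simp only [cardsLeft, Nat.sub_eq]; omega
    rw [this]
    exact NatPoly.linear (by nlinarith)

theorem natPoly_handSum {s : ℕ} (hs : 2 ≤ s) {L : List ℕ} (hL : L.length ≤ 5)
    {f : ℕ → ℕ → ℕ → ℕ → ℕ} (hf : ∀ a i j, NatPoly fun t => f t a i j) (l : List (ℕ × ℕ × ℕ)) :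
    NatPoly fun t => handSum (Nat.add t s) L (f t) l := by
  induction l with
  | nil => exact NatPoly.const 0
  | cons h l ih => exact ((natPoly_handWays hs hL _ _).mul (hf _ _ _)).add ih

theorem natPoly_moveScore {s : ℕ} (hs : 2 ≤ s) (b : Bool) {n : ℕ} (hn : n ≤ 5) (T u : ℕ)
    {L : List ℕ} (hL : L.length ≤ 5) : NatPoly fun t => moveScore b (Nat.add t s) n T u L := by
  cases b
  · exact (NatPoly.const _).mul (NatPoly.linear (by omega))
  · refine NatPoly.linear ?_
    have h1 := drawScoreSum_le T u L
    have h2 := deckScore_ge T u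
    nlinarith

theorem natPoly_moveSum {s : ℕ} (hs : 2 ≤ s) (b : Bool) {L : List ℕ} (hL : L.length ≤ 3) {n : ℕ}
    (hn : n ≤ 5) (k u : ℕ) (l : List (ℕ × ℕ × ℕ)) :
    NatPoly fun t => moveSum b (Nat.add t s) L n k u l :=
  natPoly_handSum hs (by omega) (fun _ _ _ => natPoly_moveScore hs b hn _ _ (by simp; omega)) l

theorem natPoly_shiftSum {s : ℕ} (hs : 2 ≤ s) {L : List ℕ} (hL : L.length ≤ 3) {n : ℕ}
    (hn : n ≤ 5) (l : List (ℕ × ℕ × ℕ)) :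
    NatPoly fun t => shiftSum (Nat.add t s) L n l :=
  natPoly_handSum hs (by omega)
    (fun _ _ _ => (NatPoly.const 2).mul (NatPoly.linear (by omega))) l

theorem natPoly_situationScore {s : ℕ} (hs : 2 ≤ s) {m e r : ℕ → ℕ}
    (hm : NatPoly m) (he : NatPoly e) (hr : NatPoly r) (b : Bool) (i j : ℕ) (k : Option ℕ) :
    NatPoly fun t => situationScore (Nat.add t s) (m t) (e t) (r t) b i j k := by
  cases k with
  | some k =>
    exact (he.mul (natPoly_moveSum hs b (by simp) le_rfl _ _ _)).add
      (hm.mul (natPoly_moveSum hs b (by simp) le_rfl _ _ _))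
  | none =>
    exact (he.mul (natPoly_moveSum hs b (by simp) (by norm_num) _ _ _)).add
      (hr.mul (natPoly_moveSum hs b (by simp) (by norm_num) _ _ _))

theorem natPoly_situationShift {s : ℕ} (hs : 2 ≤ s) {m e r : ℕ → ℕ}
    (hm : NatPoly m) (he : NatPoly e) (hr : NatPoly r) (i j : ℕ) (k : Option ℕ) :
    NatPoly fun t => situationShift (Nat.add t s) (m t) (e t) (r t) i j k := by
  cases k with
  | some k =>
    exact (he.mul (natPoly_shiftSum hs (by simp) le_rfl _)).add
      (hm.mul (natPoly_shiftSum hs (by simp) le_rfl _))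
  | none =>
    exact (he.mul (natPoly_shiftSum hs (by simp) (by norm_num) _)).add
      (hr.mul (natPoly_shiftSum hs (by simp) (by norm_num) _))

theorem natPoly_cardSum {f : ℕ → ℕ → ℕ} (hf : ∀ k, NatPoly fun t => f t k) (l : List ℕ) :
    NatPoly fun t => cardSum (f t) l := by
  induction l with
  | nil => exact NatPoly.const 0
  | cons a l ih => exact (hf a).add ih

theorem natPoly_situationSum {s : ℕ} (hs : 2 ≤ s) {f : ℕ → ℕ → ℕ → Option ℕ → ℕ}
    (hf : ∀ i j k, NatPoly fun t => f t i j k) :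
    NatPoly fun t => situationSum (Nat.add t s) (f t) :=
  natPoly_handSum hs (by simp) (fun _ _ _ =>
    (natPoly_cardSum (fun _ => (natPoly_cardsLeft hs (by simp) _).mul (hf _ _ _)) _).add
      ((NatPoly.linear (by omega)).mul (hf _ _ _))) _

theorem natPoly_rowDraw {s : ℕ} (hs : 2 ≤ s) (N x₁ x₂ : ℕ) :
    NatPoly fun t => rowDraw N (Nat.add t s) x₁ x₂ :=
  natPoly_handSum hs (by simp) (fun _ _ _ => natPoly_cardSum (fun _ =>
    (natPoly_cardsLeft hs (by simp) _).mul (natPoly_moveScore hs _ le_rfl _ _ (by simp))) _) _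

theorem natPoly_rowStand {s : ℕ} (hs : 2 ≤ s) (N x₁ x₂ : ℕ) :
    NatPoly fun t => rowStand N (Nat.add t s) x₁ x₂ :=
  (NatPoly.linear (by omega)).mul (natPoly_handSum hs (by simp) (fun _ _ _ =>
    natPoly_moveScore hs _ (by norm_num) _ _ (by simp)) _)

theorem natPoly_rowMixed {s : ℕ} (hs : 2 ≤ s) (N : ℕ) (b : Bool) (x₁ x₂ : ℕ) :
    NatPoly fun t => rowMixed N b (Nat.add t s) x₁ x₂ :=
  (NatPoly.linear (by omega)).mul (natPoly_handSum hs (by simp) (fun _ _ _ =>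
    natPoly_moveScore hs _ (by norm_num) _ _ (by simp)) _)


/-! ### Verification of the optimality conditions -/

/-- The numerator of Player's probability for `d ≥ 2`. -/
def pNum (d : ℕ) : ℕ :=
  Nat.mul (Nat.sub (Nat.mul 12 d) 1) (Nat.add (Nat.mul d (Nat.sub (Nat.mul 16 d) 14)) 1)

/-- The denominator of Player's probability for `d ≥ 2`. -/
def pDen (d : ℕ) : ℕ := Nat.mul (Nat.mul 32 (Nat.mul d d)) (Nat.sub (Nat.mul 11 d) 1)

/-- The difference of `pDen` and `pNum`. -/
def pRest (d : ℕ) : ℕ :=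
  Nat.add (Nat.mul (Nat.mul d (Nat.mul d d)) 160)
    (Nat.add (Nat.mul d (Nat.sub (Nat.mul 152 d) 26)) 1)

/-- The numerator of Banker's probability for `d ≥ 9`. -/
def qNum (d : ℕ) : ℕ :=
  Nat.add (Nat.mul (Nat.mul d (Nat.mul d d)) (Nat.sub (Nat.mul 91648 d) 119488))
    (Nat.add (Nat.mul d (Nat.sub (Nat.mul 26032 d) 1932)) 41)

/-- The denominator of Banker's probability for `d ≥ 9`. -/
def qDen (d : ℕ) : ℕ := Nat.mul (Nat.mul 256 (Nat.mul d d))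
  (Nat.mul (Nat.sub (Nat.mul 11 d) 1) (Nat.sub (Nat.mul 52 d) 5))

/-- The test of all situations of Banker. -/
def allSituations (f : ℕ → ℕ → Option ℕ → Bool) : Bool :=
  playHands.all fun h => f h.2.1 h.2.2 none && cards.all fun k => f h.2.1 h.2.2 (some k)

/-- The comparison that Banker's table demands of the payoffs for drawing and for standing. -/
def tableTest {α : Type} (N : ℕ) (le : α → α → Bool) (a b : α) (i j : ℕ) (k : Option ℕ) : Bool :=
  match isMixed N i j k with
  | true => le a b && le b a
  | false => match tableMove N i j k with
    | true => le a b
    | false => le b a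

/-- The test of a situation of Banker for `d` decks. -/
def situationTest (N d m e r i j : ℕ) (k : Option ℕ) : Bool :=
  tableTest N Nat.ble (situationScore d m e r true i j k) (situationScore d m e r false i j k) i j k

/-- The test of a situation of Banker for all numbers of decks from `s` on. -/
def situationPolyTest (s i j : ℕ) (k : Option ℕ) : Bool :=
  tableTest 9 polyLe
    (fun t => situationScore (Nat.add t s) (pNum (Nat.add t s)) (pDen (Nat.add t s))
      (pRest (Nat.add t s)) true i j k)
    (fun t => situationScore (Nat.add t s) (pNum (Nat.add t s)) (pDen (Nat.add t s))
      (pRest (Nat.add t s)) false i j k) i j k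

/-- The table indices for which the table differs from the limit, except `1`. -/
def middle : List ℕ := [2, 3, 4, 5, 6, 7, 8]

/-- The test of a situation of Banker for all numbers of decks except `1`. -/
def situationUniformTest (i j : ℕ) (k : Option ℕ) : Bool :=
  match middle.all fun N => tableMove N i j k == tableMove 9 i j k with
  | true => situationPolyTest 2 i j k
  | false => (middle.all fun d => situationTest d d (pNum d) (pDen d) (pRest d) i j k) &&
      situationPolyTest 9 i j k

/-- One deck, with `p = 1 / 19` and therefore weights 1, 19 and 18. The equality at `(8, 8)` when
Player stands is Banker's indifference. -/
theorem banker_test_one : allSituations (situationTest 1 1 1 19 18) = true := by decide +kernel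

/-- All `d ≥ 2` at once. At `(0, 6)` when Player stands, the test is an identity of polynomials,
which expresses that `pNum / pDen` makes Banker indifferent. -/
theorem banker_test : allSituations situationUniformTest = true := by decide +kernel

/-- The test of the value `- a / b` for `d` decks. -/
def valueTest (N d m e r a b : ℕ) : Bool :=
  Nat.beq (Nat.add (Nat.mul (valueScore N d m e r) b) (Nat.mul e a))
    (Nat.mul (valueShift d m e r) b)

/-- The test of Player's decisions on the hands with total `5`. -/
def choiceTest {α : Type} (le : α → α → Bool) (a b : ℕ → ℕ → α) : Bool :=
  (choiceDrawHands.all fun h => le (b h.1 h.2) (a h.1 h.2)) &&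
    ((le (a 1 4) (b 1 4) && le (b 1 4) (a 1 4)) && le (a 2 3) (b 2 3))

/-- The shifted score for drawing, when Banker draws on `mixedHand N` with probability `u / w`,
up to terms that standing has in common. -/
def choiceDraw (N d u w x₁ x₂ : ℕ) : ℕ :=
  Nat.add (Nat.mul w (rowDraw N d x₁ x₂)) (Nat.mul u (rowMixed N false d x₁ x₂))

/-- The shifted score for standing, when Banker draws on `mixedHand N` with probability `u / w`,
up to terms that drawing has in common. -/
def choiceStand (N d u w x₁ x₂ : ℕ) : ℕ :=
  Nat.add (Nat.mul w (rowStand N d x₁ x₂)) (Nat.mul u (rowMixed N true d x₁ x₂))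

/-- The test of a solution in which Banker draws on `mixedHand N` with probability `u / w` and the
scaled value is `- a / b`. -/
def solutionTest (N d m e r u w a b : ℕ) : Bool :=
  valueTest N d m e r a b && (choiceTest Nat.ble (choiceDraw N d u w) (choiceStand N d u w) &&
    (Nat.ble u w && Nat.blt 0 w))

/-- In this and the following seven tests `u / w` is `qOpt d` and `- a / b` is `sixWays d * vOpt d`.
The equality required on `(1,4)` says that `u / w` makes Player indifferent. -/
theorem solution_test_one :
    solutionTest 1 1 1 19 18 4519 10716 3632060256 19 = true := by
  decide +kernel

theorem solution_test_two : solutionTest 2 2 (pNum 2) (pDen 2) (pRest 2)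
    17431 64512 98848020274 7 = true := by
  decide +kernel

theorem solution_test_three : solutionTest 3 3 (pNum 3) (pDen 3) (pRest 3)
    4425647 11132928 2695982336165 16 = true := by
  decide +kernel

theorem solution_test_four : solutionTest 4 4 (pNum 4) (pDen 4) (pRest 4)
    16318191 35753984 41651065424174 43 = true := by
  decide +kernel

theorem solution_test_five : solutionTest 5 5 (pNum 5) (pDen 5) (pRest 5)
    43232447 88128000 101131907918537 27 = true := by
  decide +kernel

theorem solution_test_six : solutionTest 6 6 (pNum 6) (pDen 6) (pRest 6)
    18885571 36781056 146712432406238 13 = true := by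
  decide +kernel

theorem solution_test_seven : solutionTest 7 7 (pNum 7) (pDen 7) (pRest 7)
    181348767 342250496 1088351355446941 38 = true := by
  decide +kernel

theorem solution_test_eight : solutionTest 8 8 (pNum 8) (pDen 8) (pRest 8)
    316815305 585842688 5578833895331314 87 = true := by
  decide +kernel

/-- The positive terms of the numerator of the value for `d ≥ 9`. -/
def valuePos (d : ℕ) : ℕ :=
  Nat.add (Nat.mul 1391755264 (Nat.mul (Nat.mul d (Nat.mul d d)) (Nat.mul (Nat.mul d d) (Nat.mul d d))))
    (Nat.add (Nat.mul 54174464 (Nat.mul (Nat.mul d (Nat.mul d d)) (Nat.mul d d)))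
      (Nat.add (Nat.mul 1931136 (Nat.mul (Nat.mul d d) (Nat.mul d d)))
        (Nat.add (Nat.mul 85792 (Nat.mul d d)) 41)))

/-- The negative terms of the numerator of the value for `d ≥ 9`. -/
def valueNeg (d : ℕ) : ℕ :=
  Nat.add (Nat.mul 500535296 (Nat.mul (Nat.mul d (Nat.mul d d)) (Nat.mul d (Nat.mul d d))))
    (Nat.add (Nat.mul 948816 (Nat.mul d (Nat.mul d d))) (Nat.mul 3238 d))

/-- The left-hand side of the identity for the value. -/
def valueLeft (d : ℕ) : ℕ :=
  Nat.add (Nat.mul (valueScore 9 d (pNum d) (pDen d) (pRest d)) (Nat.sub (Nat.mul 11 d) 1))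
    (Nat.mul (pDen d) (Nat.mul 2 (valuePos d)))

/-- The right-hand side of the identity for the value. -/
def valueRight (d : ℕ) : ℕ :=
  Nat.add (Nat.mul (valueShift d (pNum d) (pDen d) (pRest d)) (Nat.sub (Nat.mul 11 d) 1))
    (Nat.mul (pDen d) (Nat.mul 2 (valueNeg d)))

/-- Inequality in both directions is equality of coefficients; the negative terms of the value have
been moved to the right. Both sides have degree at most 10 in `t`, so the twelve digits read by
`polyLe` suffice. -/
theorem value_polyTest : (polyLe (fun t => valueLeft (Nat.add t 9)) (fun t => valueRight (Nat.add t 9)) &&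
    polyLe (fun t => valueRight (Nat.add t 9)) (fun t => valueLeft (Nat.add t 9))) = true := by
  decide +kernel

/-- The two comparisons on `(1,4)` form a polynomial identity: `qNum / qDen` makes Player
indifferent there for all `d ≥ 9`. -/
theorem choice_polyTest : choiceTest polyLe
    (fun x₁ x₂ t => choiceDraw 9 (Nat.add t 9) (qNum (Nat.add t 9)) (qDen (Nat.add t 9)) x₁ x₂)
    (fun x₁ x₂ t => choiceStand 9 (Nat.add t 9) (qNum (Nat.add t 9)) (qDen (Nat.add t 9)) x₁ x₂) =
    true := by
  decide +kernel

theorem qNum_polyTest :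
    polyLe (fun t => qNum (Nat.add t 9)) (fun t => qDen (Nat.add t 9)) = true := by
  decide +kernel


/-! ### From the tests to solutions -/

theorem mem_playHands_of_le : ∀ y : Hand, y.1 ≤ y.2 → ¬ 8 ≤ pairTotal y →
    (pairTotal y, y.1.val, y.2.val) ∈ playHands := by
  decide +kernel

theorem allSituations_spec {f : ℕ → ℕ → Option ℕ → Bool} (h : allSituations f = true) {y : Hand}
    (hle : y.1 ≤ y.2) (hy : ¬ 8 ≤ pairTotal y) (k : Option CardValue) :
    f y.1.val y.2.val (k.map Fin.val) = true := by
  have h1 := List.all_eq_true.1 h _ (mem_playHands_of_le y hle hy)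
  rw [Bool.and_eq_true] at h1
  cases k with
  | none => exact h1.1
  | some k =>
    have hk : ∀ k : CardValue, k.val ∈ cards := by decide
    exact List.all_eq_true.1 h1.2 _ (hk k)

/-- The meaning of `tableTest`. -/
theorem tableTest_spec {α : Type} {N : ℕ} {le : α → α → Bool} {a b : α} {i j : ℕ} {k : Option ℕ}
    (h : tableTest N le a b i j k = true) :
    if isMixed N i j k then le a b = true ∧ le b a = true
    else if tableMove N i j k then le a b = true else le b a = true := by
  unfold tableTest at h
  cases h1 : isMixed N i j k <;> cases h2 : tableMove N i j k <;> simp_all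

/-- `situationShift` is the same for drawing and for standing, so the order of the shifted natural
scores is the order of the payoffs. -/
theorem situationTest_spec {N d m e r : ℕ} (hd : 1 ≤ d) (hr : m + r = e) (he : 0 < e) {p : ℝ}
    (hp : e * p = m) {y : Hand} {k : Option CardValue}
    (h : tableTest N Nat.ble (situationScore d m e r true y.1.val y.2.val (k.map Fin.val))
      (situationScore d m e r false y.1.val y.2.val (k.map Fin.val)) y.1.val y.2.val
      (k.map Fin.val) = true) :
    if isMixed N y.1.val y.2.val (k.map Fin.val) then
      situationPayoff d p 1 y k = situationPayoff d p 0 y k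
    else if tableMove N y.1.val y.2.val (k.map Fin.val) then
      situationPayoff d p 1 y k ≤ situationPayoff d p 0 y k
    else situationPayoff d p 0 y k ≤ situationPayoff d p 1 y k := by
  have h1 := situationPayoff_eq hd hr hp true y k
  have h0 := situationPayoff_eq hd hr hp false y k
  simp only [if_true, Bool.false_eq_true, if_false] at h1 h0
  have he' : (0 : ℝ) < e := by exact_mod_cast he
  have hle : ∀ b c : Bool, Nat.ble (situationScore d m e r b y.1.val y.2.val (k.map Fin.val))
      (situationScore d m e r c y.1.val y.2.val (k.map Fin.val)) = true →
      (situationScore d m e r b y.1.val y.2.val (k.map Fin.val) : ℝ) ≤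
      situationScore d m e r c y.1.val y.2.val (k.map Fin.val) := fun b c hbc => by
    exact_mod_cast Nat.le_of_ble_eq_true hbc
  have h := tableTest_spec h
  split_ifs at h ⊢
  · have := hle _ _ h.1
    have := hle _ _ h.2
    exact mul_left_cancel₀ he'.ne' (by linarith)
  · have := hle _ _ h
    exact le_of_mul_le_mul_left (by linarith) he'
  · have := hle _ _ h
    exact le_of_mul_le_mul_left (by linarith) he'

/-- Both sides come from `pDen - pNum = 160 d ^ 3 + 152 d ^ 2 - 26 d + 1`. The identity also yields
`p ≤ 1`. -/
theorem pNum_add_pRest {d : ℕ} (hd : 2 ≤ d) : pNum d + pRest d = pDen d := by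
  obtain ⟨t, rfl⟩ := Nat.exists_eq_add_of_le hd
  simp only [pNum, pRest, pDen, Nat.add_eq, Nat.mul_eq, Nat.sub_eq]
  rw [show 12 * (2 + t) - 1 = 12 * t + 23 by omega, show 16 * (2 + t) - 14 = 16 * t + 18 by omega,
    show 152 * (2 + t) - 26 = 152 * t + 278 by omega, show 11 * (2 + t) - 1 = 11 * t + 21 by omega]
  ring

theorem pDen_pos {d : ℕ} (hd : 1 ≤ d) : 0 < pDen d := by
  simp only [pDen, Nat.mul_eq, Nat.sub_eq]
  have : 0 < 11 * d - 1 := by omega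
  positivity

theorem natPoly_pNum {s : ℕ} (hs : 2 ≤ s) : NatPoly fun t => pNum (Nat.add t s) :=
  (NatPoly.linear (by omega)).mul
    (((NatPoly.shift s).mul (NatPoly.linear (by omega))).add (NatPoly.const 1))

theorem natPoly_pDen {s : ℕ} (hs : 2 ≤ s) : NatPoly fun t => pDen (Nat.add t s) :=
  ((NatPoly.const 32).mul ((NatPoly.shift s).mul (NatPoly.shift s))).mul
    (NatPoly.linear (by omega))

theorem natPoly_pRest {s : ℕ} (hs : 2 ≤ s) : NatPoly fun t => pRest (Nat.add t s) :=
  (((NatPoly.shift s).mul ((NatPoly.shift s).mul (NatPoly.shift s))).mul (NatPoly.const 160)).add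
    (((NatPoly.shift s).mul (NatPoly.linear (by omega))).add (NatPoly.const 1))

theorem natPoly_qNum {s : ℕ} (hs : 2 ≤ s) : NatPoly fun t => qNum (Nat.add t s) :=
  (((NatPoly.shift s).mul ((NatPoly.shift s).mul (NatPoly.shift s))).mul
    (NatPoly.linear (by omega))).add
    (((NatPoly.shift s).mul (NatPoly.linear (by omega))).add (NatPoly.const 41))

theorem natPoly_qDen {s : ℕ} (hs : 2 ≤ s) : NatPoly fun t => qDen (Nat.add t s) :=
  ((NatPoly.const 256).mul ((NatPoly.shift s).mul (NatPoly.shift s))).mul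
    ((NatPoly.linear (by omega)).mul (NatPoly.linear (by omega)))

theorem situationPolyTest_spec {s d : ℕ} (hs : 2 ≤ s) (hsd : s ≤ d) {i j : ℕ} {k : Option ℕ}
    (h : situationPolyTest s i j k = true) :
    situationTest 9 d (pNum d) (pDen d) (pRest d) i j k = true := by
  obtain ⟨t, rfl⟩ := Nat.exists_eq_add_of_le hsd
  rw [add_comm s t]
  have hpoly := fun b => natPoly_situationScore hs (natPoly_pNum hs) (natPoly_pDen hs)
    (natPoly_pRest hs) b i j k
  have hle := fun b c hbc => Nat.ble_eq_true_of_le (NatPoly.le_of_polyLe (hpoly b) (hpoly c) hbc t)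
  unfold situationPolyTest tableTest at h
  unfold situationTest tableTest
  split at h
  · rw [Bool.and_eq_true] at h ⊢
    exact ⟨hle _ _ h.1, hle _ _ h.2⟩
  · split at h
    · exact hle _ _ h
    · exact hle _ _ h

theorem bankerOptimal_one : BankerOptimal 1 (1 : ℕ) (1 / 19) := by
  refine bankerOptimal_of_hands fun y k hle hy => ?_
  exact situationTest_spec le_rfl (m := 1) (e := 19) (r := 18) rfl (by norm_num) (by norm_num)
    (allSituations_spec banker_test_one hle hy k)

theorem isMixed_eq {N : ℕ} (hN : 2 ≤ N) (i j : ℕ) (k : Option ℕ) :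
    isMixed N i j k = isMixed 9 i j k := by
  cases k with
  | some k => rfl
  | none => simp [isMixed, mixedHand, show N ≠ 1 by omega]

/-- The index of Banker's table. -/
def tableIndex (d : ℕ) : ℕ := min d 9

theorem bankerOptimal {d : ℕ} (hd : 2 ≤ d) :
    BankerOptimal (tableIndex d) d (pNum d / pDen d) := by
  have he := pDen_pos (show 1 ≤ d by omega)
  have he' : (pDen d : ℝ) ≠ 0 := by exact_mod_cast he.ne'
  refine bankerOptimal_of_hands fun y k hle hy => ?_
  refine situationTest_spec (by omega) (pNum_add_pRest hd) he (mul_div_cancel₀ _ he') ?_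
  have h := allSituations_spec banker_test hle hy k
  generalize y.1.val = i at h ⊢
  generalize y.2.val = j at h ⊢
  generalize k.map Fin.val = k at h ⊢
  change situationTest (tableIndex d) d (pNum d) (pDen d) (pRest d) i j k = true
  by_cases hd9 : 9 ≤ d
  · rw [tableIndex, min_eq_right hd9]
    unfold situationUniformTest at h
    split at h
    · exact situationPolyTest_spec le_rfl hd h
    · rw [Bool.and_eq_true] at h
      exact situationPolyTest_spec (by norm_num) hd9 h.2
  · have hmem : d ∈ middle := by simp [middle]; omega
    rw [tableIndex, min_eq_left (by omega)]
    unfold situationUniformTest at h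
    split at h
    · rename_i hall
      -- The polynomial test refers to table 9, which agrees with table `d` in this situation.
      have ht := List.all_eq_true.1 hall d hmem
      have := situationPolyTest_spec le_rfl hd h
      unfold situationTest tableTest at this ⊢
      rwa [isMixed_eq hd, eq_of_beq ht]
    · rw [Bool.and_eq_true] at h
      exact List.all_eq_true.1 h.1 d hmem

theorem choiceTest_spec {N d u w : ℕ} (hd : 1 ≤ d) (hw : 0 < w) {q : ℝ} (hq : w * q = u)
    (h : choiceTest Nat.ble (choiceDraw N d u w) (choiceStand N d u w) = true) :
    PlayerOptimal N d q := by
  have hw' : (0 : ℝ) < w := by exact_mod_cast hw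
  have key : ∀ i j : ℕ, i < 10 → j < 10 → w * drawGain d (bankerMix N q) (toCard i, toCard j) =
      choiceDraw N d u w i j - choiceStand N d u w i j := by
    intro i j hi hj
    rw [drawGain_eq N q hd]
    simp only [val_toCard hi, val_toCard hj, choiceDraw, choiceStand, Nat.add_eq, Nat.mul_eq,
      Nat.cast_add, Nat.cast_mul, ← hq]
    ring
  have hle : ∀ a b : ℕ, Nat.ble a b = true → (a : ℝ) ≤ b := fun a b hab => by
    exact_mod_cast Nat.le_of_ble_eq_true hab
  simp only [choiceTest, Bool.and_eq_true, List.all_eq_true] at h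
  obtain ⟨h1, ⟨h2, h3⟩, h4⟩ := h
  refine ⟨fun x hx => ?_, ?_, ?_⟩
  · have hlt : ∀ x ∈ choiceDrawHands, x.1 < 10 ∧ x.2 < 10 := by decide
    have := key x.1 x.2 (hlt x hx).1 (hlt x hx).2
    have := hle _ _ (h1 x hx)
    exact nonneg_of_mul_nonneg_right (by linarith : 0 ≤ (w : ℝ) * _) hw'
  · have := key 1 4 (by norm_num) (by norm_num)
    have := hle _ _ h2
    have := hle _ _ h3
    exact (mul_eq_zero.1 (by linarith : (w : ℝ) * _ = 0)).resolve_left hw'.ne'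
  · have := key 2 3 (by norm_num) (by norm_num)
    have := hle _ _ h4
    exact nonpos_of_mul_nonpos_right (by linarith : (w : ℝ) * _ ≤ 0) hw'

theorem choiceTest_of_polyTest {d : ℕ} (hd : 9 ≤ d) :
    choiceTest Nat.ble (choiceDraw 9 d (qNum d) (qDen d)) (choiceStand 9 d (qNum d) (qDen d)) =
      true := by
  obtain ⟨t, rfl⟩ := Nat.exists_eq_add_of_le hd
  rw [add_comm 9 t]
  have h9 : 2 ≤ 9 := by norm_num
  have hA : ∀ i j, NatPoly fun t =>
      choiceDraw 9 (Nat.add t 9) (qNum (Nat.add t 9)) (qDen (Nat.add t 9)) i j := fun i j =>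
    ((natPoly_qDen h9).mul (natPoly_rowDraw h9 9 i j)).add
      ((natPoly_qNum h9).mul (natPoly_rowMixed h9 9 false i j))
  have hB : ∀ i j, NatPoly fun t =>
      choiceStand 9 (Nat.add t 9) (qNum (Nat.add t 9)) (qDen (Nat.add t 9)) i j := fun i j =>
    ((natPoly_qDen h9).mul (natPoly_rowStand h9 9 i j)).add
      ((natPoly_qNum h9).mul (natPoly_rowMixed h9 9 true i j))
  have h := choice_polyTest
  simp only [choiceTest, Bool.and_eq_true, List.all_eq_true] at h ⊢
  obtain ⟨h1, ⟨h2, h3⟩, h4⟩ := h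
  exact ⟨fun x hx => Nat.ble_eq_true_of_le (NatPoly.le_of_polyLe (hB _ _) (hA _ _) (h1 x hx) t),
    ⟨Nat.ble_eq_true_of_le (NatPoly.le_of_polyLe (hA _ _) (hB _ _) h2 t),
      Nat.ble_eq_true_of_le (NatPoly.le_of_polyLe (hB _ _) (hA _ _) h3 t)⟩,
    Nat.ble_eq_true_of_le (NatPoly.le_of_polyLe (hA _ _) (hB _ _) h4 t)⟩

theorem valueTest_spec {N d m e r a b : ℕ} (hd : 1 ≤ d) (hr : m + r = e) (he : 0 < e) {p : ℝ}
    (hp : e * p = m) (h : valueTest N d m e r a b = true) :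
    b * scaledPayoff d (playerMix p) (bankerProb (bankerStands N)) = -a := by
  have h' : valueScore N d m e r * b + e * a = valueShift d m e r * b := Nat.eq_of_beq_eq_true h
  have h'' : (valueScore N d m e r : ℝ) * b + e * a = valueShift d m e r * b := by
    exact_mod_cast h'
  have he' : (e : ℝ) ≠ 0 := by exact_mod_cast he.ne'
  have := value_eq N hd hr hp
  refine mul_left_cancel₀ he' ?_
  linear_combination (b : ℝ) * this + h''

theorem value_identity {d : ℕ} (hd : 9 ≤ d) : valueLeft d = valueRight d := by
  obtain ⟨t, rfl⟩ := Nat.exists_eq_add_of_le hd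
  rw [add_comm 9 t]
  have h9 : 2 ≤ 9 := by norm_num
  have hX := NatPoly.shift 9
  have hS : NatPoly fun t => valueScore 9 (Nat.add t 9) (pNum (Nat.add t 9)) (pDen (Nat.add t 9))
      (pRest (Nat.add t 9)) :=
    natPoly_situationSum h9 fun i j k => natPoly_situationScore h9 (natPoly_pNum h9)
      (natPoly_pDen h9) (natPoly_pRest h9) _ i j k
  have hT : NatPoly fun t => valueShift (Nat.add t 9) (pNum (Nat.add t 9)) (pDen (Nat.add t 9))
      (pRest (Nat.add t 9)) :=
    natPoly_situationSum h9 fun i j k => natPoly_situationShift h9 (natPoly_pNum h9)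
      (natPoly_pDen h9) (natPoly_pRest h9) i j k
  have hpos : NatPoly fun t => valuePos (Nat.add t 9) :=
    ((NatPoly.const _).mul ((hX.mul (hX.mul hX)).mul ((hX.mul hX).mul (hX.mul hX)))).add
      (((NatPoly.const _).mul ((hX.mul (hX.mul hX)).mul (hX.mul hX))).add
        (((NatPoly.const _).mul ((hX.mul hX).mul (hX.mul hX))).add
          (((NatPoly.const _).mul (hX.mul hX)).add (NatPoly.const _))))
  have hneg : NatPoly fun t => valueNeg (Nat.add t 9) :=
    ((NatPoly.const _).mul ((hX.mul (hX.mul hX)).mul (hX.mul (hX.mul hX)))).add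
      (((NatPoly.const _).mul (hX.mul (hX.mul hX))).add ((NatPoly.const _).mul hX))
  have hL : NatPoly fun t => valueLeft (Nat.add t 9) :=
    (hS.mul (NatPoly.linear (by norm_num))).add
      ((natPoly_pDen h9).mul ((NatPoly.const _).mul hpos))
  have hR : NatPoly fun t => valueRight (Nat.add t 9) :=
    (hT.mul (NatPoly.linear (by norm_num))).add
      ((natPoly_pDen h9).mul ((NatPoly.const _).mul hneg))
  have h := value_polyTest
  rw [Bool.and_eq_true] at h
  exact le_antisymm (NatPoly.le_of_polyLe hL hR h.1 t) (NatPoly.le_of_polyLe hR hL h.2 t)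


/-! ### Assembly of the solution from the optimality conditions. -/

/-- Each deal involves only one decision of Player, so the outcome is affine in his drawing
probabilities. Mixing two pure strategies is therefore the same as drawing with the averaged
probabilities; the same holds for Banker. -/
theorem scaledPayoff_playerMix_eq (d p : ℝ) (b : Hand → Option CardValue → ℝ) :
    scaledPayoff d (playerMix p) b = (1 - p) * scaledPayoff d (playerProb playerStands14) b +
      p * scaledPayoff d (playerProb playerDraws14) b := by
  simp only [scaledPayoff, Finset.mul_sum, ← Finset.sum_add_distrib]
  refine Finset.sum_congr rfl fun x _ => Finset.sum_congr rfl fun y _ =>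
    Finset.sum_congr rfl fun k _ => Finset.sum_congr rfl fun l _ => ?_
  simp only [outcome, playerMix]
  split_ifs <;> ring

theorem scaledPayoff_bankerMix_eq (d q : ℝ) (a : Hand → ℝ) (N : ℕ) :
    scaledPayoff d a (bankerMix N q) = (1 - q) * scaledPayoff d a (bankerProb (bankerStands N)) +
      q * scaledPayoff d a (bankerProb (bankerDraws N)) := by
  simp only [scaledPayoff, Finset.mul_sum, ← Finset.sum_add_distrib]
  refine Finset.sum_congr rfl fun x _ => Finset.sum_congr rfl fun y _ =>
    Finset.sum_congr rfl fun k _ => Finset.sum_congr rfl fun l _ => ?_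
  simp only [outcome, bankerMix]
  split_ifs <;> ring

theorem sixWays_pos {d : ℕ} (hd : 1 ≤ d) : 0 < sixWays d := by
  have h1 : (1 : ℝ) ≤ d := by exact_mod_cast hd
  have e0 : 0 < 52 * (d : ℝ) := by linarith
  have e1 : 0 < 52 * (d : ℝ) - 1 := by linarith
  have e2 : 0 < 52 * (d : ℝ) - 2 := by linarith
  have e3 : 0 < 52 * (d : ℝ) - 3 := by linarith
  have e4 : 0 < 52 * (d : ℝ) - 4 := by linarith
  have e5 : 0 < 52 * (d : ℝ) - 5 := by linarith
  unfold sixWays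
  positivity

/-- Player's guarantee compares an arbitrary strategy of Banker with `bankerStands`. Banker's
guarantee compares an arbitrary strategy of Player with `playerMix p` against `bankerMix N q`, which
yields the same payoff by Banker's indifference. -/
theorem isSolution_of_optimal {N d : ℕ} (hd : 1 ≤ d) {p q v : ℝ} (hp0 : 0 ≤ p) (hp1 : p ≤ 1)
    (hq0 : 0 ≤ q) (hq1 : q ≤ 1) (hB : BankerOptimal N d p) (hP : PlayerOptimal N d q)
    (hv : scaledPayoff d (playerMix p) (bankerProb (bankerStands N)) = sixWays d * v) :
    MatrixGame.IsSolution (payoff (shoe d)) (playerMixed p) (bankerMixed N q) v := by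
  have hw := sixWays_pos hd
  refine MatrixGame.isSolution_of_guarantees
    (MatrixGame.rowGuarantees_of_forall_pure
      (MatrixGame.twoPoint_mem_stdSimplex hp0 hp1 _ _) fun T => ?_)
    (MatrixGame.colGuarantees_of_forall_pure
      (MatrixGame.twoPoint_mem_stdSimplex hq0 hq1 _ _) fun S => ?_)
  · rw [playerMixed, MatrixGame.sum_twoPoint_mul p _ _ fun S => payoff (shoe d) S T]
    refine le_of_mul_le_mul_left ?_ hw
    rw [← hv, mul_add, mul_left_comm, mul_left_comm _ p, sixWays_mul_payoff hd,
      sixWays_mul_payoff hd, ← scaledPayoff_playerMix_eq]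
    exact hB.le_scaledPayoff hd T
  · rw [bankerMixed, MatrixGame.sum_twoPoint_mul q _ _ fun T => payoff (shoe d) S T]
    refine le_of_mul_le_mul_left ?_ hw
    rw [← hv, mul_add, mul_left_comm, mul_left_comm _ q, sixWays_mul_payoff hd,
      sixWays_mul_payoff hd, ← scaledPayoff_bankerMix_eq, ← hB.scaledPayoff_bankerMix hd q]
    exact hP.scaledPayoff_le hd p S

theorem bankerTable_limit {d : ℕ} (hd : 9 ≤ d) : bankerTable d = bankerTable 9 := by
  have h1 : ¬ d = 1 := by omega
  have h2 : ¬ d ≤ 2 := by omega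
  have h3 : 2 ≤ d := by omega
  have h4 : 8 ≤ d := by omega
  have h5 : 4 ≤ d := by omega
  funext h k
  unfold bankerTable
  simp only [h1, h2, h3, h4, h5, hd]
  norm_num

theorem mixedHand_eq {d : ℕ} (hd : 2 ≤ d) : mixedHand d = (0, 6) := by
  simp [mixedHand, show d ≠ 1 by omega]

theorem bankerMixed_limit {d : ℕ} (hd : 9 ≤ d) (q : ℝ) : bankerMixed d q = bankerMixed 9 q := by
  have h1 : bankerStands d = bankerStands 9 := by
    simp only [bankerStands, bankerTable_limit hd]
  have h2 : bankerDraws d = bankerDraws 9 := by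
    simp only [bankerDraws, bankerTable_limit hd, mixedHand_eq (show 2 ≤ d by omega),
      mixedHand_eq (show 2 ≤ 9 by norm_num)]
  rw [bankerMixed, bankerMixed, h1, h2]

theorem isSolution_of_test {N d m e r u w a b : ℕ} (hd : 1 ≤ d) (hr : m + r = e) (he : 0 < e)
    (hb : 0 < b) (hB : BankerOptimal N d (m / e)) (h : solutionTest N d m e r u w a b = true)
    {v : ℝ} (hv : sixWays d * v = -(a / b)) :
    MatrixGame.IsSolution (payoff (shoe d)) (playerMixed (m / e)) (bankerMixed N (u / w)) v := by
  simp only [solutionTest, Bool.and_eq_true, Nat.blt_eq] at h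
  obtain ⟨h1, h2, h3, h4⟩ := h
  have he' : (0 : ℝ) < e := by exact_mod_cast he
  have hw' : (0 : ℝ) < w := by exact_mod_cast h4
  have hb' : (0 : ℝ) < b := by exact_mod_cast hb
  have hme : (m : ℝ) ≤ e := by exact_mod_cast (by omega : m ≤ e)
  have huw : (u : ℝ) ≤ w := by exact_mod_cast Nat.le_of_ble_eq_true h3
  refine isSolution_of_optimal hd (by positivity) ((div_le_one he').2 hme) (by positivity)
    ((div_le_one hw').2 huw) hB
    (choiceTest_spec hd h4 (mul_div_cancel₀ _ hw'.ne') h2) ?_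
  have := valueTest_spec hd hr he (mul_div_cancel₀ _ he'.ne') h1
  rw [hv]
  field_simp
  linarith

/-! ### The closed formulas for the probabilities and the value. -/

theorem pOpt_eq {d : ℕ} (hd : 2 ≤ d) : pOpt d = pNum d / pDen d := by
  rw [pOpt, if_neg (by omega)]
  simp only [pNum, pDen, Nat.add_eq, Nat.mul_eq, Nat.sub_eq]
  push_cast [show 1 ≤ 12 * d by omega, show 14 ≤ 16 * d by omega, show 1 ≤ 11 * d by omega]
  congr 1 <;> ring

theorem qOpt_eq {d : ℕ} (hd : 9 ≤ d) : qOpt d = qNum d / qDen d := by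
  rw [qOpt, if_neg (by omega), if_neg (by omega), if_neg (by omega), if_neg (by omega),
    if_neg (by omega)]
  simp only [qNum, qDen, Nat.add_eq, Nat.mul_eq, Nat.sub_eq]
  push_cast [show 119488 ≤ 91648 * d by omega, show 1932 ≤ 26032 * d by omega,
    show 1 ≤ 11 * d by omega, show 5 ≤ 52 * d by omega]
  congr 1 <;> ring

theorem descFactorial_eq {d : ℕ} (hd : 1 ≤ d) : (((52 * d).descFactorial 6 : ℕ) : ℝ) = sixWays d := by
  simp only [Nat.descFactorial_succ, Nat.descFactorial_zero, Nat.sub_zero, sixWays]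
  push_cast [show 5 ≤ 52 * d by omega, show 4 ≤ 52 * d by omega, show 3 ≤ 52 * d by omega,
    show 2 ≤ 52 * d by omega, show 1 ≤ 52 * d by omega]
  ring

theorem isSolution_one : MatrixGame.IsSolution (payoff (shoe 1)) (playerMixed (pOpt 1))
    (bankerMixed 1 (qOpt 1)) (vOpt 1) := by
  have hB : BankerOptimal 1 (1 : ℕ) ((1 : ℕ) / (19 : ℕ)) := by
    have := bankerOptimal_one
    norm_num only at this ⊢
    exact this
  have h := isSolution_of_test (v := vOpt 1) (m := 1) (e := 19) (r := 18) le_rfl rfl (by norm_num)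
    (by norm_num) hB solution_test_one (by norm_num [vOpt, sixWays])
  have hp : pOpt 1 = (1 : ℕ) / (19 : ℕ) := by norm_num [pOpt]
  have hq : qOpt 1 = (4519 : ℕ) / (10716 : ℕ) := by norm_num [qOpt]
  rw [hp, hq]
  exact h

theorem isSolution_middle {d u w a b : ℕ} (h2 : 2 ≤ d) (h8 : d ≤ 8) (hb : 0 < b)
    (h : solutionTest d d (pNum d) (pDen d) (pRest d) u w a b = true) (hq : qOpt d = u / w)
    (hv : sixWays d * vOpt d = -(a / b)) :
    MatrixGame.IsSolution (payoff (shoe d)) (playerMixed (pOpt d)) (bankerMixed d (qOpt d))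
      (vOpt d) := by
  have hB := bankerOptimal h2
  rw [tableIndex, min_eq_left (by omega)] at hB
  rw [hq, pOpt_eq h2]
  exact isSolution_of_test (by omega) (pNum_add_pRest h2) (pDen_pos (by omega)) hb hB h hv

theorem isSolution_large {d : ℕ} (hd : 9 ≤ d) :
    MatrixGame.IsSolution (payoff (shoe d)) (playerMixed (pOpt d)) (bankerMixed d (qOpt d))
      (vOpt d) := by
  have hB := bankerOptimal (show 2 ≤ d by omega)
  rw [tableIndex, min_eq_right hd] at hB
  have he := pDen_pos (show 1 ≤ d by omega)
  have he' : (0 : ℝ) < pDen d := by exact_mod_cast he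
  have hr := pNum_add_pRest (show 2 ≤ d by omega)
  have hw : 0 < qDen d := by
    simp only [qDen, Nat.mul_eq, Nat.sub_eq]
    have : 0 < 11 * d - 1 := by omega
    have : 0 < 52 * d - 5 := by omega
    positivity
  have hw' : (0 : ℝ) < qDen d := by exact_mod_cast hw
  have huw : qNum d ≤ qDen d := by
    obtain ⟨t, rfl⟩ := Nat.exists_eq_add_of_le hd
    rw [add_comm]
    exact NatPoly.le_of_polyLe (natPoly_qNum (s := 9) (by norm_num))
      (natPoly_qDen (s := 9) (by norm_num)) qNum_polyTest t
  have hme : (pNum d : ℝ) ≤ pDen d := by exact_mod_cast (by omega : pNum d ≤ pDen d)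
  have huw' : (qNum d : ℝ) ≤ qDen d := by exact_mod_cast huw
  rw [bankerMixed_limit hd, pOpt_eq (by omega), qOpt_eq hd]
  have hnn : ∀ a b : ℕ, (0 : ℝ) ≤ a / b := fun a b => by positivity
  refine isSolution_of_optimal (by omega) (hnn _ _) ((div_le_one he').2 hme) (hnn _ _)
    ((div_le_one hw').2 huw') hB
    (choiceTest_spec (by omega) hw (mul_div_cancel₀ _ hw'.ne') (choiceTest_of_polyTest hd)) ?_
  have hval := value_eq 9 (show 1 ≤ d by omega) hr (mul_div_cancel₀ (pNum d : ℝ) he'.ne')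
  have hid : (valueLeft d : ℝ) = valueRight d := by rw [value_identity hd]
  have hv : vOpt d = -2 * (valuePos d - valueNeg d) / ((11 * d - 1) * sixWays d) := by
    rw [vOpt, if_neg (by omega), if_neg (by omega), if_neg (by omega), if_neg (by omega),
      if_neg (by omega), descFactorial_eq (by omega)]
    congr 1
    simp only [valuePos, valueNeg, Nat.add_eq, Nat.mul_eq]
    push_cast
    ring
  simp only [valueLeft, valueRight, Nat.add_eq, Nat.mul_eq, Nat.sub_eq] at hid
  push_cast [show 1 ≤ 11 * d by omega] at hid
  have hd1 : (1 : ℝ) ≤ d := by exact_mod_cast (by omega : 1 ≤ d)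
  have h11 : (0 : ℝ) < 11 * d - 1 := by linarith
  have hs := sixWays_pos (show 1 ≤ d by omega)
  rw [hv]
  refine mul_left_cancel₀ (mul_pos he' h11).ne' ?_
  have hrhs : (pDen d : ℝ) * (11 * d - 1) *
      (sixWays d * (-2 * (valuePos d - valueNeg d) / ((11 * d - 1) * sixWays d))) =
      pDen d * (-2 * (valuePos d - valueNeg d)) := by
    field_simp
  rw [hrhs]
  -- With `pDen d * (11 * d - 1)` cleared, the claim is the evaluation of the payoff, `hval`,
  -- combined with the polynomial identity for the value, `hid`.
  linear_combination (11 * (d : ℝ) - 1) * hval + hid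

theorem isSolution_shoe {d : ℕ} (hd : 1 ≤ d) :
    MatrixGame.IsSolution (payoff (shoe d)) (playerMixed (pOpt d)) (bankerMixed d (qOpt d))
      (vOpt d) := by
  rcases Nat.lt_or_ge d 9 with h | h
  swap
  · exact isSolution_large h
  interval_cases d
  · exact isSolution_one
  · exact isSolution_middle (by norm_num) (by norm_num) (by norm_num) solution_test_two
      (by norm_num [qOpt]) (by norm_num [vOpt, sixWays])
  · exact isSolution_middle (by norm_num) (by norm_num) (by norm_num) solution_test_three
      (by norm_num [qOpt]) (by norm_num [vOpt, sixWays])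
  · exact isSolution_middle (by norm_num) (by norm_num) (by norm_num) solution_test_four
      (by norm_num [qOpt]) (by norm_num [vOpt, sixWays, Nat.descFactorial])
  · exact isSolution_middle (by norm_num) (by norm_num) (by norm_num) solution_test_five
      (by norm_num [qOpt]) (by norm_num [vOpt, sixWays, Nat.descFactorial])
  · exact isSolution_middle (by norm_num) (by norm_num) (by norm_num) solution_test_six
      (by norm_num [qOpt]) (by norm_num [vOpt, sixWays, Nat.descFactorial])
  · exact isSolution_middle (by norm_num) (by norm_num) (by norm_num) solution_test_seven
      (by norm_num [qOpt]) (by norm_num [vOpt, sixWays, Nat.descFactorial])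
  · exact isSolution_middle (by norm_num) (by norm_num) (by norm_num) solution_test_eight
      (by norm_num [qOpt]) (by norm_num [vOpt, sixWays])


/-! ### The limit of many decks and the game with replacement. -/

open Filter Topology

theorem tendsto_inv_decks : Tendsto (fun d : ℕ => ((d : ℝ))⁻¹) atTop (𝓝 0) :=
  tendsto_inv_atTop_nhds_zero_nat

/-- A function of `d` that is eventually a function of `1 / d` continuous at `0` converges. -/
theorem tendsto_of_eventually_inv {f : ℕ → ℝ} {g : ℝ → ℝ} {c : ℝ} (hg : ContinuousAt g 0)
    (hc : g 0 = c) (h : ∀ d : ℕ, 9 ≤ d → f d = g (d : ℝ)⁻¹) : Tendsto f atTop (𝓝 c) := by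
  rw [← hc]
  refine (hg.tendsto.comp tendsto_inv_decks).congr' ?_
  filter_upwards [eventually_ge_atTop 9] with d hd
  exact (h d hd).symm

theorem tendsto_pOpt : Tendsto pOpt atTop (𝓝 (6 / 11)) := by
  -- Numerator and denominator are divided by `d ^ 3`, and `u` stands for `1 / d`.
  refine tendsto_of_eventually_inv
    (g := fun u => (12 - u) * (16 - 14 * u + u ^ 2) / (32 * (11 - u))) ?_ (by norm_num)
    fun d hd => ?_
  · refine ContinuousAt.div (by fun_prop) (by fun_prop) (by norm_num)
  · have hd' : (9 : ℝ) ≤ d := by exact_mod_cast hd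
    have h0 : (d : ℝ) ≠ 0 := by linarith
    have h1 : 11 * (d : ℝ) - 1 ≠ 0 := by linarith
    have h2 : 11 - (d : ℝ)⁻¹ ≠ 0 := by
      have : (11 - (d : ℝ)⁻¹) * d = 11 * d - 1 := by field_simp
      exact left_ne_zero_of_mul (this ▸ h1)
    rw [pOpt, if_neg (by omega), div_eq_div_iff (by positivity) (by positivity)]
    field_simp

theorem tendsto_qOpt : Tendsto qOpt atTop (𝓝 (179 / 286)) := by
  -- Here the common factor is `d ^ 4`.
  refine tendsto_of_eventually_inv
    (g := fun u => (91648 - 119488 * u + 26032 * u ^ 2 - 1932 * u ^ 3 + 41 * u ^ 4) /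
      (256 * (11 - u) * (52 - 5 * u))) ?_ (by norm_num)
    fun d hd => ?_
  · refine ContinuousAt.div (by fun_prop) (by fun_prop) (by norm_num)
  · have hd' : (9 : ℝ) ≤ d := by exact_mod_cast hd
    have h0 : (d : ℝ) ≠ 0 := by linarith
    have h1 : 11 * (d : ℝ) - 1 ≠ 0 := by linarith
    have h3 : 52 * (d : ℝ) - 5 ≠ 0 := by linarith
    have h2 : 11 - (d : ℝ)⁻¹ ≠ 0 := by
      have : (11 - (d : ℝ)⁻¹) * d = 11 * d - 1 := by field_simp
      exact left_ne_zero_of_mul (this ▸ h1)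
    have h4 : 52 - 5 * (d : ℝ)⁻¹ ≠ 0 := by
      have : (52 - 5 * (d : ℝ)⁻¹) * d = 52 * d - 5 := by field_simp
      exact left_ne_zero_of_mul (this ▸ h3)
    rw [qOpt, if_neg (by omega), if_neg (by omega), if_neg (by omega), if_neg (by omega),
      if_neg (by omega), div_eq_div_iff (by positivity) (by positivity)]
    field_simp

theorem tendsto_vOpt : Tendsto vOpt atTop (𝓝 (-679568 / 53094899)) := by
  -- Here the common factor is `d ^ 7`: six powers from the falling factorial and one from `11 * d -
  -- 1`.
  refine tendsto_of_eventually_inv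
    (g := fun u => -2 * (1391755264 - 500535296 * u + 54174464 * u ^ 2 + 1931136 * u ^ 3
      - 948816 * u ^ 4 + 85792 * u ^ 5 - 3238 * u ^ 6 + 41 * u ^ 7) /
      ((11 - u) * (52 * (52 - u) * (52 - 2 * u) * (52 - 3 * u) * (52 - 4 * u) * (52 - 5 * u))))
    ?_ (by norm_num) fun d hd => ?_
  · refine ContinuousAt.div (by fun_prop) (by fun_prop) (by norm_num)
  · have hd' : (9 : ℝ) ≤ d := by exact_mod_cast hd
    have h0 : (d : ℝ) ≠ 0 := by linarith
    have hden : (11 - (d : ℝ)⁻¹) * (52 * (52 - (d : ℝ)⁻¹) * (52 - 2 * (d : ℝ)⁻¹) *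
        (52 - 3 * (d : ℝ)⁻¹) * (52 - 4 * (d : ℝ)⁻¹) * (52 - 5 * (d : ℝ)⁻¹)) * d ^ 7 =
        (11 * d - 1) * sixWays d := by
      unfold sixWays; field_simp
    have h1 : (11 * (d : ℝ) - 1) * sixWays d ≠ 0 :=
      mul_ne_zero (by linarith) (sixWays_pos (show 1 ≤ d by omega)).ne'
    have h2 := left_ne_zero_of_mul (hden ▸ h1)
    rw [vOpt, if_neg (by omega), if_neg (by omega), if_neg (by omega), if_neg (by omega),
      if_neg (by omega), descFactorial_eq (by omega), div_eq_div_iff h1 h2, ← hden]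
    field_simp

theorem tendsto_shoe (L : List CardValue) (v : CardValue) :
    Tendsto (fun d : ℕ => shoe d L v) atTop (𝓝 (withReplacement L v)) := by
  have hinv := tendsto_inv_decks
  have h : Tendsto (fun d : ℕ => (deckCount v - (L.count v : ℝ) * (d : ℝ)⁻¹) /
      (52 - (L.length : ℝ) * (d : ℝ)⁻¹)) atTop
      (𝓝 ((deckCount v - (L.count v : ℝ) * 0) / (52 - (L.length : ℝ) * 0))) :=
    (tendsto_const_nhds.sub (hinv.const_mul _)).div
      (tendsto_const_nhds.sub (hinv.const_mul _)) (by norm_num)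
  simp only [mul_zero, sub_zero] at h
  refine h.congr' ?_
  filter_upwards [eventually_ge_atTop 1] with d hd
  have h0 : (d : ℝ) ≠ 0 := by exact_mod_cast (by omega : d ≠ 0)
  rw [shoe, ← mul_div_mul_right _ _ h0]
  congr 1 <;> field_simp

theorem tendsto_profit (S : PlayerPure) (T : BankerPure) (x₁ x₂ y₁ y₂ : CardValue) :
    Tendsto (fun d : ℕ => profit (shoe d) S T x₁ x₂ y₁ y₂) atTop
      (𝓝 (profit withReplacement S T x₁ x₂ y₁ y₂)) := by
  unfold profit
  split_ifs
  · exact tendsto_const_nhds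
  · refine tendsto_finsetSum _ fun k _ => (tendsto_shoe _ _).mul ?_
    split_ifs
    · exact tendsto_finsetSum _ fun l _ => (tendsto_shoe _ _).mul_const _
    · exact tendsto_const_nhds
  · exact tendsto_finsetSum _ fun l _ => (tendsto_shoe _ _).mul_const _
  · exact tendsto_const_nhds

theorem tendsto_payoff (S : PlayerPure) (T : BankerPure) :
    Tendsto (fun d : ℕ => payoff (shoe d) S T) atTop (𝓝 (payoff withReplacement S T)) :=
  tendsto_finsetSum _ fun _ _ => (tendsto_shoe _ _).mul <|
    tendsto_finsetSum _ fun _ _ => (tendsto_shoe _ _).mul <|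
    tendsto_finsetSum _ fun _ _ => (tendsto_shoe _ _).mul <|
    tendsto_finsetSum _ fun _ _ => (tendsto_shoe _ _).mul (tendsto_profit ..)

theorem tendsto_expected {p : ℕ → PlayerPure → ℝ} {p' : PlayerPure → ℝ}
    {q : ℕ → BankerPure → ℝ} {q' : BankerPure → ℝ}
    (hp : ∀ S, Tendsto (fun d => p d S) atTop (𝓝 (p' S)))
    (hq : ∀ T, Tendsto (fun d => q d T) atTop (𝓝 (q' T))) :
    Tendsto (fun d : ℕ => MatrixGame.expected (payoff (shoe d)) (p d) (q d)) atTop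
      (𝓝 (MatrixGame.expected (payoff withReplacement) p' q')) :=
  tendsto_finsetSum _ fun S _ => tendsto_finsetSum _ fun T _ =>
    ((hp S).mul (hq T)).mul (tendsto_payoff S T)

theorem tendsto_playerMixed (S : PlayerPure) :
    Tendsto (fun d => playerMixed (pOpt d) S) atTop (𝓝 (playerMixed (6 / 11) S)) := by
  simp only [playerMixed, Pi.add_apply, Pi.smul_apply, smul_eq_mul]
  exact ((tendsto_const_nhds.sub tendsto_pOpt).mul_const _).add (tendsto_pOpt.mul_const _)

theorem tendsto_bankerMixed (T : BankerPure) :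
    Tendsto (fun d => bankerMixed 9 (qOpt d) T) atTop (𝓝 (bankerMixed 9 (179 / 286) T)) := by
  simp only [bankerMixed, Pi.add_apply, Pi.smul_apply, smul_eq_mul]
  exact ((tendsto_const_nhds.sub tendsto_qOpt).mul_const _).add (tendsto_qOpt.mul_const _)

/-- Against a fixed strategy of the opponent, the guarantee for each `d ≥ 9` is a weak inequality
between convergent sequences and survives the limit. Banker's two pure strategies must not vary with
`d` for this, which `bankerMixed_limit` provides. -/
theorem isSolution_withReplacement {d : ℕ} (hd : 9 ≤ d) :
    MatrixGame.IsSolution (payoff withReplacement) (playerMixed (6 / 11))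
      (bankerMixed d (179 / 286)) (-679568 / 53094899) := by
  rw [bankerMixed_limit hd]
  refine MatrixGame.isSolution_of_guarantees
    ⟨MatrixGame.twoPoint_mem_stdSimplex (by norm_num) (by norm_num) _ _, fun q hq => ?_⟩
    ⟨MatrixGame.twoPoint_mem_stdSimplex (by norm_num) (by norm_num) _ _, fun p hp => ?_⟩
  · refine le_of_tendsto_of_tendsto tendsto_vOpt
      (tendsto_expected tendsto_playerMixed fun _ => tendsto_const_nhds) ?_
    filter_upwards [eventually_ge_atTop 9] with e he
    exact (isSolution_shoe (show 1 ≤ e by omega)).2.1.2 q hq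
  · refine le_of_tendsto_of_tendsto
      (tendsto_expected (fun _ => tendsto_const_nhds) tendsto_bankerMixed) tendsto_vOpt ?_
    filter_upwards [eventually_ge_atTop 9] with e he
    have := (isSolution_shoe (show 1 ≤ e by omega)).2.2.2 p hp
    rwa [bankerMixed_limit he] at this

end Baccara

theorem theorem5 :
    (∀ d : ℕ, 1 ≤ d →
      MatrixGame.IsSolution (Baccara.payoff (Baccara.shoe d))
        (Baccara.playerMixed (Baccara.pOpt d)) (Baccara.bankerMixed d (Baccara.qOpt d))
        (Baccara.vOpt d)) ∧
    Filter.Tendsto Baccara.pOpt Filter.atTop (nhds (6 / 11)) ∧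
    Filter.Tendsto Baccara.qOpt Filter.atTop (nhds (179 / 286)) ∧
    Filter.Tendsto Baccara.vOpt Filter.atTop (nhds (-679568 / 53094899)) ∧
    -- The limit is a solution of the game with replacement; `bankerTable` is constant from 9 on.
    ∀ d : ℕ, 9 ≤ d →
      MatrixGame.IsSolution (Baccara.payoff Baccara.withReplacement)
        (Baccara.playerMixed (6 / 11)) (Baccara.bankerMixed d (179 / 286))
        (-679568 / 53094899) :=
  ⟨fun _ hd => Baccara.isSolution_shoe hd, Baccara.tendsto_pOpt, Baccara.tendsto_qOpt,
    Baccara.tendsto_vOpt, fun _ hd => Baccara.isSolution_withReplacement hd⟩
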